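/- **Setting.** For each sample size $n$ let $X_{1,n},\dots,X_{n,n}$ be fixed points of a predictor space $\mathcal X$; for $R\subseteq\mathcal X$ let $n_R$ be the number of $i$ with $X_{i,n}\in R$. Let $l_1,\dots,l_m$ be a partition of $\mathcal X$ (the leaves of the observed tree), and let $p_1=\mathcal X\supseteq p_2\supseteq\dots\supseteq p_d\supseteq p_{d+1}:=l_1$ be the path of regions leading to $l_1$. For $h\le d$ let $s_h^1,\dots,s_h^{k_h}$ be the candidate binary splits of $p_h$, where $s_h^k$ divides $p_h$ into $p_h^k\subseteq p_h$ and $p_h\setminus p_h^k$, and $p_h^1=p_{h+1}$; thus $s_h^1$ is the observed split. The numbers $m$, $d$, $k_h$ are fixed; the regions may depend on $n$. Write $n_1=n_{l_1}$ and $n_R^1=n_{R\cap l_1}$. The outcomes $Y_1,\dots,Y_n$ are independent, $Y_i\sim\mathrm{Bernoulli}(\theta_{i,n})$, $\theta_{i,n}=\sum_{j}\pi_{j,n}\mathbf 1[X_{i,n}\in l_j]$, with $\pi_{j,n}\in(0,1)$. For a region $R$ let $\hat\pi_R=n_R^{-1}\sum_iY_i\mathbf 1[X_{i,n}\in R]$.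 Given an impurity function $\mathcal I$, the gain of $s_h^k$ is $$G_h^k(Y)=\mathcal I(\hat\pi_{p_h})-\frac{n_{p_h^k}}{n_{p_h}}\mathcal I(\hat\pi_{p_h^k})-\frac{n_{p_h\setminus p_h^k}}{n_{p_h}}\mathcal I(\hat\pi_{p_h\setminus p_h^k}).$$ Given $Y$, splits $S_1,\dots,S_d$ at $p_1,\dots,p_d$ are drawn independently by the exponential mechanism with fixed temperature parameters $\epsilon_h$: $\mathbb P(S_h=s_h^k\mid Y)=e^{\epsilon_hG_h^k(Y)}/\sum_{k'}e^{\epsilon_hG_h^{k'}(Y)}$. **Key statistics and pivot.** Let $\hat T_{n,1}=\sqrt{n_1}\,\hat\pi_{l_1}$ and $\hat\pi_{-1}(R)=\sqrt{n_R}\,\hat\pi_R-\frac{n_R^1}{\sqrt{n_1n_R}}\hat T_{n,1}$. Let $\hat T_{n,-1}$ be the vector of all $\hat\pi_{-1}(p_h)$ and $\hat\pi_{-1}(p_h^k)$, $h\le d$, $2\le k\le k_h$, let $\hat T_n=(\hat T_{n,1},\hat T_{n,-1})$, and let $\Sigma_n=\mathrm{Cov}(\hat T_n)$, the regions being held fixed.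 The proportions $\hat\pi_R$ entering the gains are linear functions of $\hat T_n$ (namely $\hat\pi_R=\frac{n_R^1}{n_R\sqrt{n_1}}\hat T_{n,1}+\frac1{\sqrt{n_R}}\hat\pi_{-1}(R)$ for $R=p_h,p_h^k$, where $\hat\pi_{-1}(l_1)=0$, and $\hat\pi_{p_h\setminus p_h^k}=(n_{p_h}\hat\pi_{p_h}-n_{p_h^k}\hat\pi_{p_h^k})/(n_{p_h}-n_{p_h^k})$). Replacing $\hat T_n$ by a free variable $(u,v)$ in them turns $G_h^k$ into a function $\mathcal G_h^k(u,v)$, defined on the set $\tilde D_n$ of all $(u,v)$ for which all these linear functions take values in $(0,1)$. Put $\lambda_h=e^{\epsilon_h\mathcal G_h^1}/\sum_ke^{\epsilon_h\mathcal G_h^k}$ on $\tilde D_n$ and $\lambda_h=0$ outside. With $\Pi_{n,1}=\sqrt{n_1}\,\pi_{1,n}$, $\sigma_{n,1}^2=\pi_{1,n}(1-\pi_{1,n})$, and $\phi(\cdot;\mu,\sigma^2)$ the normal density, let $$\mathrm{Pivot}(\hat T_{n,1};\Pi_{n,1})=\frac{\int_{-\infty}^{\hat T_{n,1}}\phi(u;\Pi_{n,1},\sigma_{n,1}^2)\prod_{h=1}^d\lambda_h(u,\hat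 T_{n,-1})\,du}{\int_{-\infty}^{\infty}\phi(u;\Pi_{n,1},\sigma_{n,1}^2)\prod_{h=1}^d\lambda_h(u,\hat T_{n,-1})\,du}$$ if $\hat T_n\in\tilde D_n$, and $0$ otherwise. **Theorem.** Assume: 1. $\limsup_{n\to\infty}n/n_R<\infty$ for $R\in\{l_1,\ p_h^k,\ p_h\setminus p_h^k:\ h\le d,\ k\le k_h\}$; 2. $\liminf_n\pi_{j,n}>0$ and $\limsup_n\pi_{j,n}<1$ for all $j\le m$; 3. there are constants $b,B>0$ such that, for all sufficiently large $n$, $\Sigma_n$ is positive definite and all its eigenvalues lie in $(1/b^2,B^2)$; 4. $\mathcal I$ is bounded and three times differentiable on $(0,1)$, with bounded first, second and third derivatives there ($\mathcal I$ may take any real values at $0$ and $1$). Then the event $\{S_h=s_h^1\text{ for all }h\le d\}$ has positive probability for every $n$, and conditionally on it $\mathrm{Pivot}(\hat T_{n,1};\Pi_{n,1})$ converges in distribution to the uniform distribution on $[0,1]$ as $n\to\infty$. -/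

import Mathlib

open MeasureTheory ProbabilityTheory Filter Topology
open scoped ENNReal

noncomputable section

namespace ExpTree

/-! ## Samples, information gain and the exponential mechanism -/

/-- The number `n_R` of the sample points `X i` that lie in the region `R`. -/
def count {𝒳 : Type*} {n : ℕ} (X : Fin n → 𝒳) (R : Set 𝒳) : ℕ :=
  {i : Fin n | X i ∈ R}.ncard

/-- The proportion of ones, `(1 / n_R) ∑ i, Y_i 1[X_i ∈ R]`, among the binary outcomes observed in
the region `R` (`true` is the outcome `1`, `false` is the outcome `0`). -/
def prop {𝒳 : Type*} {n : ℕ} (X : Fin n → 𝒳) (y : Fin n → Bool) (R : Set 𝒳) : ℝ :=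
  (1 / (count X R : ℝ)) * ∑ i, (if y i then (1 : ℝ) else 0) * R.indicator 1 (X i)

/-- The information gain of the binary split of the region `P` into `Q` and `P \ Q`, for the
impurity function `I`. -/
def gain {𝒳 : Type*} {n : ℕ} (I : ℝ → ℝ) (X : Fin n → 𝒳) (y : Fin n → Bool) (P Q : Set 𝒳) : ℝ :=
  I (prop X y P) -
    ((count X Q : ℝ) / (count X P : ℝ) * I (prop X y Q) +
      (count X (P \ Q) : ℝ) / (count X P : ℝ) * I (prop X y (P \ Q)))

/-- The exponential mechanism with temperature parameter `ε` at the region `P`: the probability of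
drawing, given the outcomes `y`, the split of `P` into `Q s` and `P \ Q s`, the candidate splits
being indexed by `Fin k`. -/
def splitProb {𝒳 : Type*} {n k : ℕ} (I : ℝ → ℝ) (ε : ℝ) (X : Fin n → 𝒳) (y : Fin n → Bool)
    (P : Set 𝒳) (Q : Fin k → Set 𝒳) (s : Fin k) : ℝ :=
  Real.exp (ε * gain I X y P (Q s)) / ∑ s', Real.exp (ε * gain I X y P (Q s'))

/-! ## The observed tree -/

/-- An observed tree fit on the predictor space `𝒳`, as far as it concerns the first leaf:
a partition of `𝒳` into `m` leaves, the path of regions from the root `𝒳` to the first leaf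
(leaf `0`), and for each of the `d` internal regions of the path its `k h` candidate splits, of
which the one with index `0` is the split that was observed. A split is given by one of the two
regions that it creates; for the observed split this is the next region on the path. -/
structure TreeFit (𝒳 : Type*) (d m : ℕ) (k : Fin d → ℕ) [NeZero m] [∀ h, NeZero (k h)] where
  /-- the internal regions of the path, from the root on, followed by the first leaf -/
  node : Fin (d + 1) → Set 𝒳
  /-- the candidate regions obtained by splitting the internal regions of the path -/
  child : ∀ h : Fin d, Fin (k h) → Set 𝒳
  /-- the leaves -/
  leaf : Fin m → Set 𝒳
  node_zero : node 0 = Set.univ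
  node_last : node (Fin.last d) = leaf 0
  child_subset : ∀ h j, child h j ⊆ node h.castSucc
  child_zero : ∀ h, child h 0 = node h.succ
  leaf_disjoint : Pairwise (Function.onFun Disjoint leaf)
  leaf_cover : ⋃ j, leaf j = Set.univ

/-- The success probability `θ = ∑ j, π_j 1[x ∈ l_j]` of an outcome at the predictor value `x`. -/
def TreeFit.theta {𝒳 : Type*} {d m : ℕ} {k : Fin d → ℕ} [NeZero m] [∀ h, NeZero (k h)]
    (t : TreeFit 𝒳 d m k) (π : Fin m → ℝ) (x : 𝒳) : ℝ :=
  ∑ j, π j * (t.leaf j).indicator 1 x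

/-! ## Key statistics -/

/-- The index set of the nuisance statistics: `⟨h, 0⟩` stands for the internal region `p_h`, and
`⟨h, j⟩` with `j ≠ 0` for the candidate region number `j` of `p_h`. -/
abbrev NuisIdx {d : ℕ} (k : Fin d → ℕ) : Type := Σ h : Fin d, Fin (k h)

/-- The index set, of size `1 + ∑ h, k h`, of all key statistics; `none` is the index of the main
statistic. -/
abbrev StatIdx {d : ℕ} (k : Fin d → ℕ) : Type := Option (NuisIdx k)

section Tree

variable {𝒳 : Type*} {d m : ℕ} {k : Fin d → ℕ} [NeZero m] [∀ h, NeZero (k h)]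

/-- The region to which a nuisance statistic belongs. -/
def TreeFit.region (t : TreeFit 𝒳 d m k) (a : NuisIdx k) : Set 𝒳 :=
  if a.2 = 0 then t.node a.1.castSucc else t.child a.1 a.2

/-- The main statistic: `√n₁` times the sample proportion in the first leaf. -/
def mainStat {n : ℕ} (t : TreeFit 𝒳 d m k) (X : Fin n → 𝒳) (y : Fin n → Bool) : ℝ :=
  √(count X (t.leaf 0)) * prop X y (t.leaf 0)

/-- The orthogonalized proportion of a region `R`. -/
def orthStat {n : ℕ} (t : TreeFit 𝒳 d m k) (X : Fin n → 𝒳) (y : Fin n → Bool) (R : Set 𝒳) : ℝ :=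
  √(count X R) * prop X y R -
    (count X (R ∩ t.leaf 0) : ℝ) / √((count X (t.leaf 0) : ℝ) * (count X R : ℝ)) *
      (√(count X (t.leaf 0)) * prop X y (t.leaf 0))

/-- The vector of nuisance statistics. -/
def nuisStat {n : ℕ} (t : TreeFit 𝒳 d m k) (X : Fin n → 𝒳) (y : Fin n → Bool) : NuisIdx k → ℝ :=
  fun a => orthStat t X y (t.region a)

/-- The vector of key statistics. -/
def keyStat {n : ℕ} (t : TreeFit 𝒳 d m k) (X : Fin n → 𝒳) (y : Fin n → Bool) : StatIdx k → ℝ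
  | none => mainStat t X y
  | some a => nuisStat t X y a

/-- The covariance matrix of the key statistics when the outcomes are the random vector `Y`, the
tree being held fixed. -/
def covMatrix {n : ℕ} {Ω : Type*} [MeasurableSpace Ω] (t : TreeFit 𝒳 d m k) (X : Fin n → 𝒳)
    (Y : Fin n → Ω → Bool) (P : Measure Ω) : Matrix (StatIdx k) (StatIdx k) ℝ :=
  Matrix.of fun a b =>
    cov[fun ω => keyStat t X (fun i => Y i ω) a, fun ω => keyStat t X (fun i => Y i ω) b; P]

/-! ## Gains and selection probabilities as functions of the key statistics -/

/-- The scaling vector `η` of the split of `P` into `Q` and `P \ Q`, where `L` is the first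
leaf. -/
def eta {n : ℕ} (X : Fin n → 𝒳) (L P Q : Set 𝒳) : Fin 8 → ℝ :=
  ![√(count X L) / count X P,
    1 / √(count X P),
    (count X (Q ∩ L) : ℝ) / (count X Q * √(count X L)),
    1 / √(count X Q),
    ((count X (P ∩ L) : ℝ) - count X (Q ∩ L)) / (((count X P : ℝ) - count X Q) * √(count X L)),
    √(count X P) / ((count X P : ℝ) - count X Q),
    -(√(count X Q) / ((count X P : ℝ) - count X Q)),
    (count X Q : ℝ) / count X P]

/-- The domain of `gainMap I η`: the three proportions lie strictly between `0` and `1`. -/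
def gainDomain (η : Fin 8 → ℝ) : Set (ℝ × ℝ × ℝ) :=
  {p | η 0 * p.1 + η 1 * p.2.1 ∈ Set.Ioo (0 : ℝ) 1 ∧
    η 2 * p.1 + η 3 * p.2.2 ∈ Set.Ioo (0 : ℝ) 1 ∧
    η 4 * p.1 + η 5 * p.2.1 + η 6 * p.2.2 ∈ Set.Ioo (0 : ℝ) 1}

/-- The gain of a split with scaling vector `η` as a function of three key statistics. -/
def gainMap (I : ℝ → ℝ) (η : Fin 8 → ℝ) (p : ℝ × ℝ × ℝ) : ℝ :=
  I (η 0 * p.1 + η 1 * p.2.1) - η 7 * I (η 2 * p.1 + η 3 * p.2.2) -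
    (1 - η 7) * I (η 4 * p.1 + η 5 * p.2.1 + η 6 * p.2.2)

/-- The coordinate of `v` that belongs to a region of the path; for the region that ends the path,
which is the first leaf, the orthogonalized proportion vanishes. -/
def nodeCoord (v : NuisIdx k → ℝ) : Fin (d + 1) → ℝ :=
  Fin.lastCases 0 fun h => v ⟨h, 0⟩

/-- The three statistics on which the gain of the candidate split `j` of `p_h` depends. -/
def splitArgs (u : ℝ) (v : NuisIdx k → ℝ) (h : Fin d) (j : Fin (k h)) : ℝ × ℝ × ℝ :=
  (u, nodeCoord v h.castSucc, if j = 0 then nodeCoord v h.succ else v ⟨h, j⟩)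

/-- The scaling vector of the candidate split `j` of `p_h`. -/
def splitEta {n : ℕ} (t : TreeFit 𝒳 d m k) (X : Fin n → 𝒳) (h : Fin d) (j : Fin (k h)) :
    Fin 8 → ℝ :=
  eta X (t.leaf 0) (t.node h.castSucc) (t.child h j)

/-- The values of the key statistics at which all gains along the path are defined. -/
def statDomain {n : ℕ} (t : TreeFit 𝒳 d m k) (X : Fin n → 𝒳) : Set (ℝ × (NuisIdx k → ℝ)) :=
  {p | ∀ h j, splitArgs p.1 p.2 h j ∈ gainDomain (splitEta t X h j)}

open Classical in
/-- The probability of the observed split of `p_h` as a function of the key statistics, extended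
by `0` outside of its domain. -/
def lambda {n : ℕ} (I : ℝ → ℝ) (ε : Fin d → ℝ) (t : TreeFit 𝒳 d m k) (X : Fin n → 𝒳)
    (h : Fin d) (u : ℝ) (v : NuisIdx k → ℝ) : ℝ :=
  if (u, v) ∈ statDomain t X then
    Real.exp (ε h * gainMap I (splitEta t X h 0) (splitArgs u v h 0)) /
      ∑ j, Real.exp (ε h * gainMap I (splitEta t X h j) (splitArgs u v h j))
  else 0

/-! ## The pivot -/

/-- The integrand of the pivot: the normal density with mean `Π` and variance `σ²`, corrected by
the selection probabilities. -/
def pivotDensity {n : ℕ} (I : ℝ → ℝ) (ε : Fin d → ℝ) (t : TreeFit 𝒳 d m k) (X : Fin n → 𝒳)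
    (mean var : ℝ) (v : NuisIdx k → ℝ) (u : ℝ) : ℝ :=
  gaussianPDFReal mean var.toNNReal u * ∏ h, lambda I ε t X h u v

open Classical in
/-- The pivot as a function of the key statistics, extended by `0` outside of their domain. Its
mean is `√n₁ π₁` and its variance is `π₁ (1 - π₁)`, where `π₁` is the mean of the first leaf. -/
def pivotFun {n : ℕ} (I : ℝ → ℝ) (ε : Fin d → ℝ) (t : TreeFit 𝒳 d m k) (X : Fin n → 𝒳)
    (π₁ : ℝ) (u : ℝ) (v : NuisIdx k → ℝ) : ℝ :=
  if (u, v) ∈ statDomain t X then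
    (∫ u' in Set.Iic u,
        pivotDensity I ε t X (√(count X (t.leaf 0)) * π₁) (π₁ * (1 - π₁)) v u') /
      ∫ u', pivotDensity I ε t X (√(count X (t.leaf 0)) * π₁) (π₁ * (1 - π₁)) v u'
  else 0

/-- The pivot, evaluated at the observed outcomes `y`. -/
def pivot {n : ℕ} (I : ℝ → ℝ) (ε : Fin d → ℝ) (t : TreeFit 𝒳 d m k) (X : Fin n → 𝒳)
    (π₁ : ℝ) (y : Fin n → Bool) : ℝ :=
  pivotFun I ε t X π₁ (mainStat t X y) (nuisStat t X y)

end Tree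

/-! ## Assumption on the impurity function -/

/-- On the open interval `(0, 1)`, the function `I` is bounded and three times differentiable,
with bounded first, second and third derivatives. -/
def BoundedThriceDiff (I : ℝ → ℝ) : Prop :=
  (∀ j < 3, DifferentiableOn ℝ (iteratedDeriv j I) (Set.Ioo 0 1)) ∧
    ∃ C : ℝ, ∀ j ≤ 3, ∀ x ∈ Set.Ioo (0 : ℝ) 1, |iteratedDeriv j I x| ≤ C

/-- The uniform distribution on `[0, 1]`. -/
def uniformLaw : Measure ℝ := volume.restrict (Set.Icc 0 1)

instance : IsProbabilityMeasure uniformLaw :=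
  ⟨by simp [uniformLaw]⟩

end ExpTree

end

noncomputable section

namespace ExpTree

/-! ## A central limit theorem for triangular arrays of Bernoulli variables -/

/-! The temperatures are fixed, so the splits depend on the outcomes only through finitely many
proportions, and these concentrate at their means. Hence the gains are nearly deterministic, and the
conditional probability of the observed splits given the outcomes is close, in probability, to the
number `w n` obtained by inserting the mean proportions into the gains. Bounded impurity keeps `w n`
above some `c > 0`, so conditioning on the observed splits does not change limits in distribution
(`tendstoInDistribution_cond`).

The correction inside the pivot also disappears. With the nuisance statistics held at their observed
values, moving `u` by one unit moves each recovered proportion by at most `1 / √n₁`. So `∏ λ_h` is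
nearly `w n` on a window of fixed radius `M` around the mean of the normal density, and the
complement of the window has normal mass at most `σ² / M²`. The nearly constant weight cancels
between numerator and denominator, which leaves the normal distribution function at the standardized
main statistic (`abs_reweighted_cdf_sub_le`).

That statistic is a standardized sum of i.i.d. Bernoulli variables, since the success probability is
constant on the first leaf. The central limit theorem (`tendstoInDistribution_bernoulli_array`) and
the probability integral transform (`map_cdf_gaussian`) give the uniform limit.

Both approximations are deterministic statements on the event that all proportions are `δ`-close to
their means (`abs_selectionProb_sub_and_abs_pivot_sub_le`). By Chebyshev's inequality and a union
bound, this event has probability tending to one. -/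

/-- Telescoping allows characteristic functions to be compared factor by factor, without complex
logarithms; the loss of `N` is beaten by a one-factor error of order `N ^ (-3/2)`. -/
lemma norm_pow_sub_pow_le_of_norm_le_one {a b : ℂ} (ha : ‖a‖ ≤ 1) (hb : ‖b‖ ≤ 1) (N : ℕ) :
    ‖a ^ N - b ^ N‖ ≤ N * ‖a - b‖ := by
  induction N with
  | zero => simp
  | succ N ih =>
    have h : a ^ (N + 1) - b ^ (N + 1) = a ^ N * (a - b) + (a ^ N - b ^ N) * b := by ring
    rw [h]
    calc ‖a ^ N * (a - b) + (a ^ N - b ^ N) * b‖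
        ≤ ‖a‖ ^ N * ‖a - b‖ + ‖a ^ N - b ^ N‖ * ‖b‖ := by
          refine (norm_add_le _ _).trans ?_
          rw [norm_mul, norm_mul, norm_pow]
      _ ≤ 1 * ‖a - b‖ + (N * ‖a - b‖) * 1 := by
          gcongr
          exact pow_le_one₀ (norm_nonneg _) ha
      _ = ((N + 1 : ℕ) : ℝ) * ‖a - b‖ := by push_cast; ring

/-- The characteristic function of a Bernoulli variable with mean `p`, centered. -/
def centeredBernoulliChar (p s : ℝ) : ℂ :=
  p * Complex.exp ((s * (1 - p) : ℝ) * Complex.I) +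
    (1 - p) * Complex.exp ((s * (-p) : ℝ) * Complex.I)

lemma norm_centeredBernoulliChar_le_one {p : ℝ} (hp : p ∈ Set.Icc (0 : ℝ) 1) (s : ℝ) :
    ‖centeredBernoulliChar p s‖ ≤ 1 := by
  unfold centeredBernoulliChar
  refine (norm_add_le _ _).trans ?_
  rw [norm_mul, norm_mul, Complex.norm_exp_ofReal_mul_I, Complex.norm_exp_ofReal_mul_I,
    ← Complex.ofReal_one, ← Complex.ofReal_sub, Complex.norm_real, Complex.norm_real,
    Real.norm_of_nonneg hp.1, Real.norm_of_nonneg (by linarith [hp.2])]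
  linarith

lemma norm_exp_sub_quadratic_le (x : ℂ) :
    ‖Complex.exp x - (1 + x + x ^ 2 / 2)‖ ≤ ‖x‖ ^ 3 * Real.exp ‖x‖ := by
  have h := Complex.norm_exp_sub_sum_le_norm_mul_exp x 3
  simpa [Finset.sum_range_succ, Nat.factorial] using h

/-- In the second-order expansion of both exponentials the linear terms cancel by centering, and the
quadratic ones combine through `p (1 - p)² + (1 - p) p² = p (1 - p)`. -/
lemma norm_centeredBernoulliChar_sub_le {p : ℝ} (hp : p ∈ Set.Icc (0 : ℝ) 1) (s : ℝ) :
    ‖centeredBernoulliChar p s - (1 - (s ^ 2 * (p * (1 - p)) / 2 : ℝ))‖ ≤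
      |s| ^ 3 * Real.exp |s| := by
  have key : centeredBernoulliChar p s - (1 - (s ^ 2 * (p * (1 - p)) / 2 : ℝ)) =
      (p : ℂ) * (Complex.exp ((s * (1 - p) : ℝ) * Complex.I) -
        (1 + (s * (1 - p) : ℝ) * Complex.I + ((s * (1 - p) : ℝ) * Complex.I) ^ 2 / 2)) +
      ((1 - p : ℝ) : ℂ) * (Complex.exp ((s * (-p) : ℝ) * Complex.I) -
        (1 + (s * (-p) : ℝ) * Complex.I + ((s * (-p) : ℝ) * Complex.I) ^ 2 / 2)) := by
    unfold centeredBernoulliChar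
    push_cast
    linear_combination ((s : ℂ) ^ 2 * (p * (1 - p)) / 2) * Complex.I_sq
  have bound : ∀ r : ℝ, |r| ≤ 1 → ‖Complex.exp ((s * r : ℝ) * Complex.I) -
      (1 + (s * r : ℝ) * Complex.I + ((s * r : ℝ) * Complex.I) ^ 2 / 2)‖ ≤
        |s| ^ 3 * Real.exp |s| := by
    intro r hr
    refine (norm_exp_sub_quadratic_le _).trans ?_
    have : ‖((s * r : ℝ) : ℂ) * Complex.I‖ ≤ |s| := by
      rw [norm_mul, Complex.norm_I, mul_one, Complex.norm_real, Real.norm_eq_abs, abs_mul]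
      exact mul_le_of_le_one_right (abs_nonneg _) hr
    gcongr
  rw [key]
  refine (norm_add_le _ _).trans ?_
  rw [norm_mul, norm_mul, Complex.norm_real, Complex.norm_real,
    Real.norm_of_nonneg hp.1, Real.norm_of_nonneg (by linarith [hp.2])]
  have h1 := bound (1 - p) (by rw [abs_le]; constructor <;> linarith [hp.1, hp.2])
  have h2 := bound (-p) (by rw [abs_le]; constructor <;> linarith [hp.1, hp.2])
  calc _ ≤ p * (|s| ^ 3 * Real.exp |s|) + (1 - p) * (|s| ^ 3 * Real.exp |s|) := by
        have := hp.1
        have : 0 ≤ 1 - p := by linarith [hp.2]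
        gcongr
    _ = _ := by ring

lemma norm_exp_neg_sub_one_sub_le (x : ℝ) :
    ‖(1 - (x : ℂ)) - Complex.exp ((-x : ℝ) : ℂ)‖ ≤ |x| ^ 2 * Real.exp |x| := by
  have h := Complex.norm_exp_sub_sum_le_norm_mul_exp ((-x : ℝ) : ℂ) 2
  have hsum : ∑ m ∈ Finset.range 2, ((-x : ℝ) : ℂ) ^ m / m.factorial = 1 - (x : ℂ) := by
    simp [Finset.sum_range_succ, sub_eq_add_neg]
  rw [hsum, Complex.norm_real, Real.norm_eq_abs, abs_neg] at h
  rwa [norm_sub_rev]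

/-- Powers of centered Bernoulli characteristic functions converge to the Gaussian one. -/
lemma tendsto_centeredBernoulliChar_pow {p : ℕ → ℝ} {N : ℕ → ℕ} {a : ℝ} (ha : 0 < a)
    (hp : ∀ᶠ n in atTop, p n ∈ Set.Icc a (1 - a)) (hN : Tendsto N atTop atTop) (t : ℝ) :
    Tendsto (fun n => centeredBernoulliChar (p n)
      ((√(N n * (p n * (1 - p n))))⁻¹ * t) ^ N n) atTop (𝓝 (Complex.exp (-(t ^ 2 / 2 : ℝ)))) := by
  set r : ℕ → ℝ := fun n => (√(N n))⁻¹ with hr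
  have hr0 : Tendsto r atTop (𝓝 0) :=
    tendsto_inv_atTop_zero.comp (Real.tendsto_sqrt_atTop.comp (tendsto_natCast_atTop_atTop.comp hN))
  -- Since `p (1 - p) ≥ a²`, the argument of the characteristic function is at most `r n * K` in
  -- absolute value.
  set K : ℝ := a⁻¹ * |t| with hK
  have hK0 : 0 ≤ K := by positivity
  -- This is `N` times the one-factor error bound, simplified by `N * r² = 1`.
  have hlim : Tendsto (fun n => K ^ 3 * r n * Real.exp (r n * K) +
      (t ^ 2 / 2) ^ 2 * (r n) ^ 2 * Real.exp ((r n) ^ 2 * (t ^ 2 / 2))) atTop (𝓝 0) := by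
    have h : Tendsto (fun x : ℝ => K ^ 3 * x * Real.exp (x * K) +
        (t ^ 2 / 2) ^ 2 * x ^ 2 * Real.exp (x ^ 2 * (t ^ 2 / 2))) (𝓝 0) (𝓝 0) := by
      have hc : Continuous (fun x : ℝ => K ^ 3 * x * Real.exp (x * K) +
        (t ^ 2 / 2) ^ 2 * x ^ 2 * Real.exp (x ^ 2 * (t ^ 2 / 2))) := by fun_prop
      simpa using hc.tendsto 0
    exact h.comp hr0
  rw [tendsto_iff_norm_sub_tendsto_zero]
  refine squeeze_zero' (Eventually.of_forall fun n => norm_nonneg _) ?_ hlim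
  filter_upwards [hp, hN.eventually_ge_atTop 1] with n hpn hNn
  have hN0 : (0 : ℝ) < N n := by exact_mod_cast hNn
  have hp01 : p n ∈ Set.Icc (0 : ℝ) 1 := ⟨by linarith [hpn.1], by linarith [hpn.2]⟩
  have ha1 : a ≤ 1 := by linarith [hpn.1, hpn.2]
  have hv : a ^ 2 ≤ p n * (1 - p n) := by nlinarith [hpn.1, hpn.2]
  have hv0 : 0 < p n * (1 - p n) := lt_of_lt_of_le (by positivity) hv
  set s : ℝ := (√(N n * (p n * (1 - p n))))⁻¹ * t with hs
  have hr2 : (r n) ^ 2 = (N n : ℝ)⁻¹ := by rw [hr]; simp [inv_pow, Real.sq_sqrt hN0.le]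
  have hrpos : 0 < r n := by simp only [hr]; positivity
  have hs2 : s ^ 2 * (p n * (1 - p n)) / 2 = (r n) ^ 2 * (t ^ 2 / 2) := by
    rw [hs, mul_pow, inv_pow, Real.sq_sqrt (by positivity), hr2]
    have := hv0.ne'
    generalize p n * (1 - p n) = v at this
    field_simp
  have hsabs : |s| ≤ r n * K := by
    rw [hs, Real.sqrt_mul hN0.le, mul_inv, abs_mul, abs_mul, abs_of_pos hrpos, hK, ← mul_assoc]
    have h1 : a ≤ √(p n * (1 - p n)) := Real.le_sqrt_of_sq_le hv
    rw [abs_of_pos (inv_pos.2 (ha.trans_le h1))]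
    gcongr
  -- The Gaussian characteristic function split into `N` equal factors.
  set b : ℂ := Complex.exp ((-((r n) ^ 2 * (t ^ 2 / 2)) : ℝ) : ℂ) with hb
  have hbN : b ^ N n = Complex.exp (-(t ^ 2 / 2 : ℝ)) := by
    rw [hb, ← Complex.exp_nat_mul, hr2]
    congr 1
    push_cast
    have : (N n : ℂ) ≠ 0 := by exact_mod_cast hN0.ne'
    field_simp
  have hb1 : ‖b‖ ≤ 1 := by
    rw [hb, ← Complex.ofReal_exp, Complex.norm_real, Real.norm_eq_abs, Real.abs_exp,
      Real.exp_le_one_iff]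
    have : 0 ≤ (r n) ^ 2 * (t ^ 2 / 2) := by positivity
    linarith
  rw [← hbN]
  refine (norm_pow_sub_pow_le_of_norm_le_one (norm_centeredBernoulliChar_le_one hp01 s) hb1
    (N n)).trans ?_
  have h1 := norm_centeredBernoulliChar_sub_le hp01 s
  rw [hs2] at h1
  have h2 := norm_exp_neg_sub_one_sub_le ((r n) ^ 2 * (t ^ 2 / 2))
  have hx0 : 0 ≤ (r n) ^ 2 * (t ^ 2 / 2) := by positivity
  rw [abs_of_nonneg hx0] at h2
  have hNr : (N n : ℝ) * (r n) ^ 2 = 1 := by rw [hr2]; field_simp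
  calc (N n : ℝ) * ‖centeredBernoulliChar (p n) s - b‖
      ≤ N n * (|s| ^ 3 * Real.exp |s| + ((r n) ^ 2 * (t ^ 2 / 2)) ^ 2 *
          Real.exp ((r n) ^ 2 * (t ^ 2 / 2))) := by
        gcongr
        refine (norm_sub_le_norm_sub_add_norm_sub _ _ _).trans (add_le_add h1 h2)
    _ ≤ N n * ((r n * K) ^ 3 * Real.exp (r n * K) + ((r n) ^ 2 * (t ^ 2 / 2)) ^ 2 *
          Real.exp ((r n) ^ 2 * (t ^ 2 / 2))) := by
        gcongr
    _ = (N n * (r n) ^ 2) * (K ^ 3 * r n * Real.exp (r n * K) +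
          (t ^ 2 / 2) ^ 2 * (r n) ^ 2 * Real.exp ((r n) ^ 2 * (t ^ 2 / 2))) := by ring
    _ = _ := by rw [hNr, one_mul]

lemma measureReal_eq_false {Ω : Type*} [MeasurableSpace Ω] {P : Measure Ω} [IsProbabilityMeasure P]
    {Y : Ω → Bool} (hY : Measurable Y) {p : ℝ} (hp : 0 ≤ p)
    (h : P {ω | Y ω = true} = ENNReal.ofReal p) :
    P.real {ω | Y ω = true} = p ∧ P.real {ω | Y ω = false} = 1 - p := by
  have h1 : P.real {ω | Y ω = true} = p := by
    rw [measureReal_def, h, ENNReal.toReal_ofReal hp]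
  refine ⟨h1, ?_⟩
  have : {ω | Y ω = false} = {ω | Y ω = true}ᶜ := by ext ω; simp
  have hm : MeasurableSet {ω | Y ω = true} := hY (measurableSet_singleton true)
  rw [this, probReal_compl_eq_one_sub hm, h1]

/-- The expectation of a function of a Bernoulli variable. -/
lemma integral_comp_bernoulli {E : Type*} [NormedAddCommGroup E] [NormedSpace ℝ E]
    [CompleteSpace E] {Ω : Type*} [MeasurableSpace Ω] {P : Measure Ω}
    [IsProbabilityMeasure P] {Y : Ω → Bool} (hY : Measurable Y) {p : ℝ} (hp : 0 ≤ p)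
    (h : P {ω | Y ω = true} = ENNReal.ofReal p) (F : Bool → E) :
    ∫ ω, F (Y ω) ∂P = p • F true + (1 - p) • F false := by
  obtain ⟨h1, h2⟩ := measureReal_eq_false hY hp h
  have : IsProbabilityMeasure (P.map Y) := Measure.isProbabilityMeasure_map hY.aemeasurable
  rw [← integral_map (φ := Y) (f := F) hY.aemeasurable .of_discrete,
    integral_fintype .of_finite, Fintype.sum_bool]
  rw [map_measureReal_apply hY (measurableSet_singleton _),
    map_measureReal_apply hY (measurableSet_singleton _)]
  exact congrArg₂ _ (congrArg₂ _ h1 rfl) (congrArg₂ _ h2 rfl)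

lemma charFun_centered_bernoulli {Ω : Type*} [MeasurableSpace Ω] {P : Measure Ω}
    [IsProbabilityMeasure P] {Y : Ω → Bool} (hY : Measurable Y) {p : ℝ} (hp : 0 ≤ p)
    (h : P {ω | Y ω = true} = ENNReal.ofReal p) (s : ℝ) :
    charFun (P.map fun ω => (if Y ω then (1 : ℝ) else 0) - p) s = centeredBernoulliChar p s := by
  have hm : Measurable fun ω => (if Y ω then (1 : ℝ) else 0) - p :=
    (measurable_of_countable fun b : Bool => (if b then (1 : ℝ) else 0) - p).comp hY
  rw [charFun_apply_real, integral_map hm.aemeasurable (by fun_prop)]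
  rw [integral_comp_bernoulli hY hp h
    (fun b => Complex.exp (s * ((if b then (1 : ℝ) else 0) - p : ℝ) * Complex.I))]
  simp [centeredBernoulliChar]

/-- **Central limit theorem** for triangular arrays of Bernoulli variables that are identically
distributed in each row. -/
theorem tendstoInDistribution_bernoulli_array {Ω : ℕ → Type*} [∀ n, MeasurableSpace (Ω n)]
    {P : (n : ℕ) → Measure (Ω n)} [∀ n, IsProbabilityMeasure (P n)] {ι : ℕ → Type*}
    {Y : (n : ℕ) → ι n → Ω n → Bool} (hY : ∀ n i, Measurable (Y n i))
    (hind : ∀ n, iIndepFun (Y n) (P n)) {p : ℕ → ℝ} {a : ℝ} (ha : 0 < a)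
    (hp0 : ∀ n, 0 ≤ p n) (hp : ∀ᶠ n in atTop, p n ∈ Set.Icc a (1 - a))
    {J : (n : ℕ) → Finset (ι n)} (hJ : Tendsto (fun n => (J n).card) atTop atTop)
    (hlaw : ∀ n, ∀ i ∈ J n, P n {ω | Y n i ω = true} = ENNReal.ofReal (p n)) :
    TendstoInDistribution
      (fun n ω => (√((J n).card * (p n * (1 - p n))))⁻¹ *
        ∑ i ∈ J n, ((if Y n i ω then (1 : ℝ) else 0) - p n)) atTop
      (fun x : ℝ => x) P (gaussianReal 0 1) := by
  have hb : ∀ n, Measurable fun b : Bool => (if b then (1 : ℝ) else 0) - p n :=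
    fun n => measurable_of_countable _
  have hm : ∀ n i, Measurable fun ω => (if Y n i ω then (1 : ℝ) else 0) - p n :=
    fun n i => (hb n).comp (hY n i)
  have hms : ∀ n, Measurable fun ω => ∑ i ∈ J n, ((if Y n i ω then (1 : ℝ) else 0) - p n) :=
    fun n => Finset.measurable_fun_sum _ fun i _ => hm n i
  refine ⟨fun n => ((hms n).const_mul _).aemeasurable, aemeasurable_id', ?_⟩
  refine ProbabilityMeasure.tendsto_iff_tendsto_charFun.2 fun t => ?_
  have hlim := tendsto_centeredBernoulliChar_pow ha hp hJ t
  simp only [ProbabilityMeasure.coe_mk, Measure.map_id']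
  rw [charFun_gaussianReal]
  convert hlim using 2 with n
  · rw [charFun_map_mul_comp (hms n).aemeasurable]
    have hi : iIndepFun (fun i ω => (if Y n i ω then (1 : ℝ) else 0) - p n) (P n) :=
      (hind n).comp (fun _ b => (if b then (1 : ℝ) else 0) - p n) fun _ => hb n
    rw [iIndepFun.charFun_map_fun_finsetSum_eq_prod (fun i _ => (hm n i).aemeasurable)
      (hi.restrict _), Finset.prod_apply]
    rw [Finset.prod_congr rfl fun i hi =>
      charFun_centered_bernoulli (hY n i) (hp0 n) (hlaw n i hi) _]
    rw [Finset.prod_const]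
  · push_cast
    simp

/-! ## The probability integral transform of the standard normal distribution -/

/-- An interval on which the distribution function is constant is Gaussian-null, hence Lebesgue-null
by absolute continuity. -/
lemma strictMono_cdf_gaussian : StrictMono (cdf (gaussianReal 0 1)) := by
  intro x y hxy
  refine lt_of_le_of_ne (monotone_cdf _ hxy.le) fun h => ?_
  have h0 : gaussianReal 0 1 (Set.Ioc x y) = 0 := by
    rw [← measure_cdf (gaussianReal 0 1), StieltjesFunction.measure_Ioc, h]
    simp
  have h1 := gaussianReal_absolutelyContinuous' 0 one_ne_zero h0
  rw [Real.volume_Ioc, ENNReal.ofReal_eq_zero] at h1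
  linarith

/-- Right continuity is part of the Stieltjes structure; left continuity is the absence of atoms. -/
lemma continuous_cdf_gaussian : Continuous (cdf (gaussianReal 0 1)) := by
  have : NullSingletonClass (gaussianReal 0 1) := nullSingletonClass_gaussianReal one_ne_zero
  refine continuous_iff_continuousAt.2 fun x => ?_
  refine (continuousAt_iff_continuous_left'_right'.2 ⟨?_, ?_⟩)
  · have h : (cdf (gaussianReal 0 1)).measure {x} = 0 := by
      rw [measure_cdf]; exact measure_singleton x
    rw [StieltjesFunction.measure_singleton, ENNReal.ofReal_eq_zero] at h
    have hle := (monotone_cdf (gaussianReal 0 1)).leftLim_le (le_refl x)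
    rw [(monotone_cdf _).continuousWithinAt_Iio_iff_leftLim_eq]
    linarith
  · exact ((cdf (gaussianReal 0 1)).right_continuous x).mono Set.Ioi_subset_Ici_self

/-- The distribution function of the standard normal distribution transforms it into the uniform
distribution. -/
lemma map_cdf_gaussian :
    (gaussianReal 0 1).map (cdf (gaussianReal 0 1)) = uniformLaw := by
  set G := cdf (gaussianReal 0 1) with hG
  have hc : Continuous G := continuous_cdf_gaussian
  have hpos : ∀ x, 0 < G x := fun x =>
    (cdf_nonneg _ (x - 1)).trans_lt (strictMono_cdf_gaussian (by linarith))
  have : IsProbabilityMeasure ((gaussianReal 0 1).map G) :=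
    Measure.isProbabilityMeasure_map hc.measurable.aemeasurable
  refine Measure.ext_of_Iic _ _ fun s => ?_
  rw [Measure.map_apply hc.measurable measurableSet_Iic, uniformLaw,
    Measure.restrict_apply measurableSet_Iic]
  rcases le_or_gt s 0 with hs | hs
  · have h1 : G ⁻¹' Set.Iic s = ∅ := by
      ext x; simp only [Set.mem_preimage, Set.mem_Iic, Set.mem_empty_iff_false, iff_false, not_le]
      exact hs.trans_lt (hpos x)
    have h2 : Set.Iic s ∩ Set.Icc 0 1 ⊆ {(0 : ℝ)} := by
      rintro x ⟨hx, hx0, -⟩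
      exact le_antisymm (le_trans hx hs) hx0
    rw [h1, measure_empty, measure_mono_null h2 (measure_singleton _)]
  rcases lt_or_ge s 1 with hs1 | hs1
  -- Continuity and the limits at infinity make `s` a value of `G`; strict monotonicity then makes
  -- the preimage a half-line.
  · obtain ⟨x, hx⟩ : ∃ x, G x = s := by
      refine mem_range_of_exists_le_of_exists_ge hc ?_ ?_
      · exact ((tendsto_cdf_atBot (gaussianReal 0 1)).eventually_le_const hs).exists
      · exact ((tendsto_cdf_atTop (gaussianReal 0 1)).eventually_const_le hs1).exists
    have h1 : G ⁻¹' Set.Iic s = Set.Iic x := by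
      ext y
      rw [Set.mem_preimage, Set.mem_Iic, Set.mem_Iic, ← hx, strictMono_cdf_gaussian.le_iff_le]
    have h2 : Set.Iic s ∩ Set.Icc 0 1 = Set.Icc 0 s := by
      ext y; simp only [Set.mem_inter_iff, Set.mem_Iic, Set.mem_Icc]
      constructor
      · rintro ⟨h, h', -⟩; exact ⟨h', h⟩
      · rintro ⟨h, h'⟩; exact ⟨h', h, h'.trans hs1.le⟩
    rw [h1, h2, Real.volume_Icc, ← ofReal_cdf, ← hG, hx, sub_zero]
  · have h1 : G ⁻¹' Set.Iic s = Set.univ := by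
      ext y
      simp only [Set.mem_preimage, Set.mem_Iic, Set.mem_univ, iff_true]
      exact (cdf_le_one _ y).trans hs1
    have h2 : Set.Iic s ∩ Set.Icc 0 1 = Set.Icc 0 1 :=
      Set.inter_eq_right.2 fun y hy => hy.2.trans hs1
    rw [h1, h2, measure_univ, Real.volume_Icc]
    simp

/-- A sequence that is asymptotically standard normal becomes asymptotically uniform under the
standard normal distribution function. -/
lemma tendstoInDistribution_cdf_gaussian {Ω : ℕ → Type*} [∀ n, MeasurableSpace (Ω n)]
    {P : (n : ℕ) → Measure (Ω n)} [∀ n, IsProbabilityMeasure (P n)] {Z : (n : ℕ) → Ω n → ℝ}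
    (h : TendstoInDistribution Z atTop (fun x : ℝ => x) P (gaussianReal 0 1)) :
    TendstoInDistribution (fun n ω => cdf (gaussianReal 0 1) (Z n ω)) atTop (fun x : ℝ => x) P
      uniformLaw := by
  have h1 := h.continuous_comp continuous_cdf_gaussian
  refine ⟨h1.forall_aemeasurable, aemeasurable_id', ?_⟩
  have h2 := h1.tendsto
  have h3 : (gaussianReal 0 1).map (cdf (gaussianReal 0 1) ∘ fun x => x) =
      uniformLaw.map (fun x => x) := by
    rw [Measure.map_id', ← map_cdf_gaussian]
    rfl
  simp_rw [h3] at h2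
  exact h2

/-- The distribution function of a normal distribution, as an integral of its density. -/
lemma integral_Iic_gaussianPDFReal (μ : ℝ) {v : ℝ} (hv : 0 < v) (x : ℝ) :
    ∫ u in Set.Iic x, gaussianPDFReal μ v.toNNReal u =
      cdf (gaussianReal 0 1) ((√v)⁻¹ * (x - μ)) := by
  have hv' : v.toNNReal ≠ 0 := by simpa using hv
  have h1 : (gaussianReal 0 1).map (fun y => μ + √v * y) = gaussianReal μ v.toNNReal := by
    have := gaussianReal_map_const_mul (μ := 0) (v := 1) (√v)
    have h2 : (fun y => μ + √v * y) = (fun y => μ + y) ∘ fun y => √v * y := rfl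
    rw [h2, ← Measure.map_map (by fun_prop) (by fun_prop), this, gaussianReal_map_const_add]
    congr 1
    · simp
    · ext; simp [Real.sq_sqrt hv.le, hv.le]
  rw [cdf_eq_real, measureReal_def]
  have h3 : gaussianReal 0 1 (Set.Iic ((√v)⁻¹ * (x - μ))) =
      gaussianReal μ v.toNNReal (Set.Iic x) := by
    rw [← h1, Measure.map_apply (by fun_prop) measurableSet_Iic]
    congr 1
    ext y
    simp only [Set.mem_Iic, Set.mem_preimage]
    rw [← div_eq_inv_mul, le_div_iff₀ (by positivity)]
    constructor <;> intro h <;> linarith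
  rw [h3, gaussianReal_apply_eq_integral _ hv', ENNReal.toReal_ofReal]
  exact integral_nonneg fun u => gaussianPDFReal_nonneg _ _ _

/-! ## Perturbation of a normal distribution function by a nearly constant weight -/

lemma integrable_gaussianPDFReal_mul (μ : ℝ) (v : NNReal) {ψ : ℝ → ℝ} (hψ : Measurable ψ) {C : ℝ}
    (hC : ∀ u, |ψ u| ≤ C) : Integrable fun u => gaussianPDFReal μ v u * ψ u :=
  (integrable_gaussianPDFReal μ v).mul_bdd hψ.aestronglyMeasurable
    (ae_of_all _ fun u => by simpa using hC u)

lemma integral_sq_sub_gaussianReal (μ : ℝ) (v : NNReal) :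
    Integrable (fun u => (u - μ) ^ 2) (gaussianReal μ v) ∧
      ∫ u, (u - μ) ^ 2 ∂gaussianReal μ v = v := by
  have h2 : MemLp (fun u : ℝ => u - μ) 2 (gaussianReal μ v) :=
    (memLp_id_gaussianReal' 2 (by simp)).sub (memLp_const μ)
  refine ⟨h2.integrable_sq, ?_⟩
  have h := variance_fun_id_gaussianReal (μ := μ) (v := v)
  rwa [variance_eq_integral (by fun_prop), integral_id_gaussianReal] at h

/-- Within distance `M` of the mean the error is at most `δ`; beyond it the error is at most `1 ≤ (u
- μ)² / M²`, which integrates to `v / M²`, as in Chebyshev's inequality. -/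
lemma integral_gaussianPDFReal_mul_abs_sub_le {μ : ℝ} {v : NNReal} (hv : v ≠ 0) {ψ : ℝ → ℝ}
    (hψ : Measurable ψ) (hψ0 : ∀ u, 0 ≤ ψ u) (hψ1 : ∀ u, ψ u ≤ 1) {w δ M : ℝ} (hw0 : 0 ≤ w)
    (hw1 : w ≤ 1) (hδ : 0 ≤ δ) (hM : 0 < M) (h : ∀ u, |u - μ| ≤ M → |ψ u - w| ≤ δ) :
    ∫ u, gaussianPDFReal μ v u * |ψ u - w| ≤ δ + v / M ^ 2 := by
  have h1 : ∀ u, |ψ u - w| ≤ 1 := fun u => by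
    rw [abs_le]; constructor <;> linarith [hψ0 u, hψ1 u]
  obtain ⟨hi, he⟩ := integral_sq_sub_gaussianReal μ v
  have h2 : ∀ u, |ψ u - w| ≤ δ + (u - μ) ^ 2 / M ^ 2 := by
    intro u
    rcases le_or_gt |u - μ| M with hu | hu
    · exact (h u hu).trans (le_add_of_nonneg_right (by positivity))
    · have : 1 ≤ (u - μ) ^ 2 / M ^ 2 := by
        rw [one_le_div (by positivity), ← sq_abs (u - μ)]
        gcongr
      linarith [h1 u]
  calc ∫ u, gaussianPDFReal μ v u * |ψ u - w|
      = ∫ u, |ψ u - w| ∂gaussianReal μ v := by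
        rw [integral_gaussianReal_eq_integral_smul hv]; rfl
    _ ≤ ∫ u, (δ + (u - μ) ^ 2 / M ^ 2) ∂gaussianReal μ v := by
        refine integral_mono ?_ ((integrable_const δ).add (hi.div_const _)) h2
        exact Integrable.of_bound (by fun_prop) 1 (ae_of_all _ fun u => by simpa using h1 u)
    _ = δ + v / M ^ 2 := by
        rw [integral_add (integrable_const δ) (hi.div_const _), integral_div, he]
        simp

/-- If the weight `ψ` is nearly constant near the mean of a normal distribution, the distribution
function of the reweighted normal distribution is close to the original one. -/
lemma abs_reweighted_cdf_sub_le {μ : ℝ} {v : NNReal} (hv : v ≠ 0) {ψ : ℝ → ℝ}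
    (hψ : Measurable ψ) (hψ0 : ∀ u, 0 ≤ ψ u) (hψ1 : ∀ u, ψ u ≤ 1) {w δ M : ℝ} (hw0 : 0 < w)
    (hw1 : w ≤ 1) (hδ : 0 ≤ δ) (hM : 0 < M) (h : ∀ u, |u - μ| ≤ M → |ψ u - w| ≤ δ) (x : ℝ) :
    |(∫ u in Set.Iic x, gaussianPDFReal μ v u * ψ u) / (∫ u, gaussianPDFReal μ v u * ψ u) -
      ∫ u in Set.Iic x, gaussianPDFReal μ v u| ≤ 2 * (δ + v / M ^ 2) / w := by
  have hI := integral_gaussianPDFReal_mul_abs_sub_le hv hψ hψ0 hψ1 hw0.le hw1 hδ hM h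
  set φ := gaussianPDFReal μ v
  have hφ0 : ∀ u, 0 ≤ φ u := gaussianPDFReal_nonneg μ v
  have hφ : Integrable φ := integrable_gaussianPDFReal μ v
  have hφψ : Integrable fun u => φ u * ψ u :=
    integrable_gaussianPDFReal_mul μ v hψ (C := 1) fun u => by
      rw [abs_of_nonneg (hψ0 u)]; exact hψ1 u
  have habs : Integrable fun u => φ u * |ψ u - w| := by
    refine integrable_gaussianPDFReal_mul μ v (by fun_prop) (C := 1) fun u => ?_
    rw [abs_abs, abs_le]; constructor <;> linarith [hψ0 u, hψ1 u]
  set e := δ + v / M ^ 2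
  -- Used for the half-line (numerator) and for the whole line (denominator).
  have key : ∀ s : Set ℝ, |(∫ u in s, φ u * ψ u) - w * ∫ u in s, φ u| ≤ e := by
    intro s
    rw [← integral_const_mul, ← integral_sub hφψ.restrict (hφ.restrict.const_mul w)]
    calc |∫ u in s, (φ u * ψ u - w * φ u)| ≤ ∫ u in s, |φ u * ψ u - w * φ u| :=
          abs_integral_le_integral_abs
      _ = ∫ u in s, φ u * |ψ u - w| := by
          congr 1; ext u
          rw [show φ u * ψ u - w * φ u = φ u * (ψ u - w) by ring, abs_mul, abs_of_nonneg (hφ0 u)]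
      _ ≤ ∫ u, φ u * |ψ u - w| :=
          setIntegral_le_integral habs (ae_of_all _ fun u => mul_nonneg (hφ0 u) (abs_nonneg _))
      _ ≤ e := hI
  have hN := key (Set.Iic x)
  have hD := key Set.univ
  rw [setIntegral_univ, setIntegral_univ, integral_gaussianPDFReal_eq_one μ hv, mul_one] at hD
  set N := ∫ u in Set.Iic x, φ u * ψ u
  set D := ∫ u, φ u * ψ u
  set Φ := ∫ u in Set.Iic x, φ u
  have hnn : ∀ u, 0 ≤ φ u * ψ u := fun u => mul_nonneg (hφ0 u) (hψ0 u)
  have hN0 : 0 ≤ N := integral_nonneg hnn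
  have hND : N ≤ D := setIntegral_le_integral hφψ (ae_of_all _ hnn)
  rw [le_div_iff₀ hw0]
  have hratio : |N / D| ≤ 1 := by
    rw [abs_of_nonneg (div_nonneg hN0 (hN0.trans hND))]
    exact div_le_one_of_le₀ hND (hN0.trans hND)
  -- Multiplying by `w` instead of `D` avoids a lower bound on `D`: only `N / D ≤ 1` is needed, and
  -- `D = 0` is covered by `N / 0 = 0`.
  have hsplit : (N / D - Φ) * w = N / D * (w - D) + (N - w * Φ) := by
    rcases eq_or_ne D 0 with h0 | h0
    · have : N = 0 := le_antisymm (h0 ▸ hND) hN0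
      rw [h0, this]; simp; ring
    · field_simp
      ring
  calc |N / D - Φ| * w = |(N / D - Φ) * w| := by rw [abs_mul, abs_of_pos hw0]
    _ ≤ |N / D| * |w - D| + |N - w * Φ| := by
        rw [hsplit, ← abs_mul]; exact abs_add_le _ _
    _ ≤ 1 * e + e := by
        rw [abs_sub_comm w D]
        gcongr
    _ = 2 * e := by ring

/-! ## Conditioning on an event of nearly deterministic conditional probability -/

/-- Off the bad event, the Lipschitz bound costs `L * κ` and replacing `W` by `w` costs `K * κ`; on
it, each of the two integrands is at most `K`. -/
lemma abs_integral_mul_sub_le {Ω : Type*} [MeasurableSpace Ω] {P : Measure Ω}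
    [IsProbabilityMeasure P] {V U W : Ω → ℝ} (hV : Measurable V) (hU : Measurable U)
    (hW : Measurable W) (hW0 : ∀ ω, 0 ≤ W ω) (hW1 : ∀ ω, W ω ≤ 1) {w : ℝ} (hw0 : 0 ≤ w)
    (hw1 : w ≤ 1) {f : ℝ → ℝ} {K : ℝ} (hf : Measurable f) (hK : ∀ x, |f x| ≤ K) {L : NNReal}
    (hL : LipschitzWith L f) {κ : ℝ} (hκ : 0 ≤ κ) :
    |(∫ ω, f (V ω) * W ω ∂P) - w * ∫ ω, f (U ω) ∂P| ≤
      (L + K) * κ + 2 * K * P.real {ω | κ < |W ω - w| ∨ κ < |V ω - U ω|} := by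
  have hK0 : 0 ≤ K := (abs_nonneg _).trans (hK 0)
  set B := {ω | κ < |W ω - w| ∨ κ < |V ω - U ω|} with hB
  have hm1 : Measurable fun ω => |W ω - w| := by fun_prop
  have hm2 : Measurable fun ω => |V ω - U ω| := by fun_prop
  have hBm : MeasurableSet B :=
    (measurableSet_lt measurable_const hm1).union (measurableSet_lt measurable_const hm2)
  have hi1 : Integrable (fun ω => f (V ω) * W ω) P := by
    refine Integrable.of_bound ((hf.comp hV).mul hW).aestronglyMeasurable (K * 1)
      (ae_of_all _ fun ω => ?_)
    rw [Real.norm_eq_abs, abs_mul, abs_of_nonneg (hW0 ω)]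
    exact mul_le_mul (hK _) (hW1 ω) (hW0 ω) hK0
  have hi2 : Integrable (fun ω => f (U ω)) P :=
    Integrable.of_bound (hf.comp hU).aestronglyMeasurable K (ae_of_all _ fun ω => hK _)
  have hi3 : Integrable (fun ω => B.indicator (fun _ => 2 * K) ω) P :=
    (integrable_const (2 * K)).indicator hBm
  rw [← integral_const_mul, ← integral_sub hi1 (hi2.const_mul w)]
  calc |∫ ω, (f (V ω) * W ω - w * f (U ω)) ∂P|
      ≤ ∫ ω, |f (V ω) * W ω - w * f (U ω)| ∂P := abs_integral_le_integral_abs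
    _ ≤ ∫ ω, ((L + K) * κ + B.indicator (fun _ => 2 * K) ω) ∂P := by
        refine integral_mono (hi1.sub (hi2.const_mul w)).abs
          ((integrable_const _).add hi3) fun ω => ?_
        by_cases hω : ω ∈ B
        · simp only [Set.indicator_of_mem hω]
          have h1 : |f (V ω) * W ω| ≤ K * 1 := by
            rw [abs_mul, abs_of_nonneg (hW0 ω)]
            exact mul_le_mul (hK _) (hW1 ω) (hW0 ω) hK0
          have h2 : |w * f (U ω)| ≤ 1 * K := by
            rw [abs_mul, abs_of_nonneg hw0]
            exact mul_le_mul hw1 (hK _) (abs_nonneg _) zero_le_one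
          have h3 := abs_sub (f (V ω) * W ω) (w * f (U ω))
          have h4 : 0 ≤ ((L : ℝ) + K) * κ := by positivity
          linarith
        · simp only [Set.indicator_of_notMem hω, add_zero]
          simp only [hB, Set.mem_ofPred_eq, not_or, not_lt] at hω
          have h1 : |f (V ω) - f (U ω)| ≤ L * |V ω - U ω| := by
            simpa [Real.dist_eq] using hL.dist_le_mul (V ω) (U ω)
          have hsplit : f (V ω) * W ω - w * f (U ω) =
              (f (V ω) - f (U ω)) * W ω + f (U ω) * (W ω - w) := by ring
          rw [hsplit]
          calc |(f (V ω) - f (U ω)) * W ω + f (U ω) * (W ω - w)|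
              ≤ |f (V ω) - f (U ω)| * |W ω| + |f (U ω)| * |W ω - w| := by
                rw [← abs_mul, ← abs_mul]; exact abs_add_le _ _
            _ ≤ (L * κ) * 1 + K * κ := by
                gcongr
                · exact h1.trans (by gcongr; exact hω.2)
                · rw [abs_of_nonneg (hW0 ω)]; exact hW1 ω
                · exact hK _
                · exact hω.1
            _ = (L + K) * κ := by ring
    _ = (L + K) * κ + 2 * K * P.real B := by
        rw [integral_add (integrable_const _) hi3, integral_indicator_const _ hBm]
        simp [mul_comm]

lemma tendsto_integral_mul_sub {Ω : ℕ → Type*} [∀ n, MeasurableSpace (Ω n)]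
    {P : (n : ℕ) → Measure (Ω n)} [∀ n, IsProbabilityMeasure (P n)] {V U W : (n : ℕ) → Ω n → ℝ}
    (hV : ∀ n, Measurable (V n)) (hU : ∀ n, Measurable (U n)) (hW : ∀ n, Measurable (W n))
    (hW0 : ∀ n ω, 0 ≤ W n ω) (hW1 : ∀ n ω, W n ω ≤ 1) {w : ℕ → ℝ} (hw0 : ∀ n, 0 ≤ w n)
    (hw1 : ∀ n, w n ≤ 1)
    (hlim : ∀ κ > 0, Tendsto (fun n => (P n).real {ω | κ < |W n ω - w n| ∨ κ < |V n ω - U n ω|})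
      atTop (𝓝 0))
    {f : ℝ → ℝ} {K : ℝ} (hK : ∀ x, |f x| ≤ K) {L : NNReal} (hL : LipschitzWith L f) :
    Tendsto (fun n => (∫ ω, f (V n ω) * W n ω ∂P n) - w n * ∫ ω, f (U n ω) ∂P n) atTop (𝓝 0) := by
  have hK0 : 0 ≤ K := (abs_nonneg _).trans (hK 0)
  rw [Metric.tendsto_atTop']
  intro η hη
  have hpos : 0 < (L : ℝ) + K + 1 := by positivity
  set κ := η / (2 * (L + K + 1)) with hκ
  have hκ0 : 0 < κ := by positivity
  have h := hlim κ hκ0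
  have h1 : ∀ᶠ n in atTop, 2 * K * (P n).real {ω | κ < |W n ω - w n| ∨ κ < |V n ω - U n ω|} <
      η / 2 := by
    have := (h.const_mul (2 * K)).eventually_lt_const (u := η / 2) (by simpa using hη)
    exact this
  obtain ⟨N, hN⟩ := eventually_atTop.1 h1
  refine ⟨N, fun n hn => ?_⟩
  rw [Real.dist_eq, sub_zero]
  refine (abs_integral_mul_sub_le (hV n) (hU n) (hW n) (hW0 n) (hW1 n) (hw0 n) (hw1 n)
    hL.continuous.measurable hK hL hκ0.le).trans_lt ?_
  have h2 : ((L : ℝ) + K) * κ ≤ η / 2 := by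
    have : (L + K + 1) * κ = η / 2 := by rw [hκ]; field_simp
    nlinarith
  linarith [hN n hn.le]

/-- If the conditional probability `W n` of the events `A n` is nearly a constant `w n ≥ c > 0`,
and if `V n` is close to `U n` in probability, then `V n` has, conditionally on `A n`, the same
limit in distribution as `U n`. -/
theorem tendstoInDistribution_cond {Ω : ℕ → Type*} [∀ n, MeasurableSpace (Ω n)]
    {P : (n : ℕ) → Measure (Ω n)} [∀ n, IsProbabilityMeasure (P n)] {V U W : (n : ℕ) → Ω n → ℝ}
    (hV : ∀ n, Measurable (V n)) (hU : ∀ n, Measurable (U n)) (hW : ∀ n, Measurable (W n))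
    (hW0 : ∀ n ω, 0 ≤ W n ω) (hW1 : ∀ n ω, W n ω ≤ 1) {w : ℕ → ℝ} {c : ℝ} (hc : 0 < c)
    (hw0 : ∀ n, 0 ≤ w n) (hw1 : ∀ n, w n ≤ 1) (hwc : ∀ᶠ n in atTop, c ≤ w n)
    (hlim : ∀ κ > 0, Tendsto (fun n => (P n).real {ω | κ < |W n ω - w n| ∨ κ < |V n ω - U n ω|})
      atTop (𝓝 0))
    {A : (n : ℕ) → Set (Ω n)}
    (hAV : ∀ n (f : ℝ → ℝ), ∫ ω in A n, f (V n ω) ∂P n = ∫ ω, f (V n ω) * W n ω ∂P n)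
    [∀ n, IsProbabilityMeasure ((P n)[|A n])] {ν : Measure ℝ} [IsProbabilityMeasure ν]
    (hUν : TendstoInDistribution U atTop (fun x : ℝ => x) P ν) :
    TendstoInDistribution V atTop (fun x : ℝ => x) (fun n => (P n)[|A n]) ν := by
  refine ⟨fun n => (hV n).aemeasurable, aemeasurable_id', ?_⟩
  have h1 := hUν.tendsto
  refine tendsto_iff_forall_lipschitz_integral_tendsto.2 fun f hfb hfL => ?_
  have h2 := tendsto_iff_forall_lipschitz_integral_tendsto.1 h1 f hfb hfL
  obtain ⟨C, hC⟩ := hfb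
  obtain ⟨L, hL⟩ := hfL
  have hfm : Measurable f := hL.continuous.measurable
  have hK : ∀ x, |f x| ≤ |f 0| + C := fun x => by
    have h3 := hC x 0
    rw [Real.dist_eq] at h3
    have h4 := abs_sub_abs_le_abs_sub (f x) (f 0)
    linarith
  simp only [ProbabilityMeasure.coe_mk, Measure.map_id'] at h2 ⊢
  have hU' : ∀ n, ∫ x, f x ∂((P n).map (U n)) = ∫ ω, f (U n ω) ∂P n := fun n =>
    integral_map (hU n).aemeasurable hfm.aestronglyMeasurable
  -- The conditional expectation is a ratio whose denominator is the probability of `A n`, the case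
  -- of the constant test function in `hAV`.
  have hV' : ∀ n, ∫ x, f x ∂(((P n)[|A n]).map (V n)) =
      (∫ ω, f (V n ω) * W n ω ∂P n) / ∫ ω, W n ω ∂P n := fun n => by
    rw [integral_map (hV n).aemeasurable hfm.aestronglyMeasurable, ProbabilityTheory.cond,
      integral_smul_measure, hAV]
    have h3 := hAV n fun _ => 1
    simp only [one_mul, setIntegral_const, smul_eq_mul, mul_one] at h3
    rw [← h3, ENNReal.toReal_inv, measureReal_def, smul_eq_mul, inv_mul_eq_div]
  simp_rw [hU'] at h2
  simp_rw [hV']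
  -- The constant test function shows that the probability of `A n` is asymptotically `w n`, hence
  -- eventually at least `c / 2`.
  have hq := tendsto_integral_mul_sub hV hU hW hW0 hW1 hw0 hw1 hlim (f := fun _ => 1) (K := 1)
    (by simp) (L := 0) (LipschitzWith.const 1)
  have hf := tendsto_integral_mul_sub hV hU hW hW0 hW1 hw0 hw1 hlim hK hL
  simp only [one_mul, integral_const, probReal_univ, smul_eq_mul, mul_one] at hq
  set q := fun n => ∫ ω, W n ω ∂P n
  set b := fun n => ∫ ω, f (U n ω) ∂P n
  set a := fun n => ∫ ω, f (V n ω) * W n ω ∂P n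
  -- `a - q b = (a - w b) - (q - w) b`, where `b` converges.
  have hnum : Tendsto (fun n => a n - q n * b n) atTop (𝓝 0) := by
    have h3 := hf.sub (hq.mul h2)
    rw [zero_mul, sub_zero] at h3
    refine h3.congr fun n => ?_
    ring
  have hqc : ∀ᶠ n in atTop, c / 2 ≤ q n := by
    filter_upwards [hwc, hq.eventually_const_lt (show -(c / 2) < 0 by linarith)] with n h3 h4
    linarith
  have hdiff : Tendsto (fun n => a n / q n - b n) atTop (𝓝 0) := by
    have hb := hnum.abs.const_mul (2 / c)
    rw [abs_zero, mul_zero] at hb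
    refine squeeze_zero_norm' ?_ hb
    filter_upwards [hqc] with n hn
    have hq0 : 0 < q n := lt_of_lt_of_le (by positivity) hn
    have : a n / q n - b n = (a n - q n * b n) / q n := by field_simp
    rw [this, Real.norm_eq_abs, abs_div, abs_of_pos hq0, div_eq_inv_mul]
    gcongr
    rw [inv_le_comm₀ hq0 (by positivity), inv_div]
    exact hn
  have := hdiff.add h2
  rw [zero_add] at this
  refine this.congr fun n => ?_
  ring

/-! ## The joint selection probability as a function of the gains -/

lemma mem_closedBall_gains {d : ℕ} {k : Fin d → ℕ} {K : ℝ} (hK : 0 ≤ K)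
    {g : (h : Fin d) → Fin (k h) → ℝ} (hg : ∀ h j, |g h j| ≤ K) : g ∈ Metric.closedBall (0 : (h : Fin d) → Fin (k h) → ℝ) K := by
  rw [mem_closedBall_zero_iff, pi_norm_le_iff_of_nonneg hK]
  exact fun h => (pi_norm_le_iff_of_nonneg hK).2 fun j => hg h j

variable {d : ℕ} {k : Fin d → ℕ} [∀ h, NeZero (k h)]

/-- The probability that the exponential mechanism draws the split with index `0` at all regions of
the path, as a function of the gains of all candidate splits. -/
def selectionProb (ε : Fin d → ℝ) (g : (h : Fin d) → Fin (k h) → ℝ) : ℝ :=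
  ∏ h, Real.exp (ε h * g h 0) / ∑ j, Real.exp (ε h * g h j)

lemma selectionProb_pos (ε : Fin d → ℝ) (g : (h : Fin d) → Fin (k h) → ℝ) :
    0 < selectionProb ε g :=
  Finset.prod_pos fun _ _ => div_pos (Real.exp_pos _)
    (Finset.sum_pos (fun _ _ => Real.exp_pos _) Finset.univ_nonempty)

lemma selectionProb_le_one (ε : Fin d → ℝ) (g : (h : Fin d) → Fin (k h) → ℝ) :
    selectionProb ε g ≤ 1 := by
  refine Finset.prod_le_one (fun h _ => by positivity) fun h _ => ?_
  refine div_le_one_of_le₀ ?_ (by positivity)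
  exact Finset.single_le_sum (f := fun j => Real.exp (ε h * g h j))
    (fun _ _ => (Real.exp_pos _).le) (Finset.mem_univ 0)

lemma continuous_selectionProb (ε : Fin d → ℝ) :
    Continuous fun g : (h : Fin d) → Fin (k h) → ℝ => selectionProb ε g := by
  unfold selectionProb
  refine continuous_finsetProd _ fun h _ => ?_
  refine Continuous.div (by fun_prop) (by fun_prop) fun g => ?_
  exact (Finset.sum_pos (fun _ _ => Real.exp_pos _) Finset.univ_nonempty).ne'

/-- A positive continuous function attains a positive minimum on the compact ball of gains. The
gains are bounded uniformly in `n`, so `c` does not depend on `n`. -/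
lemma exists_le_selectionProb (ε : Fin d → ℝ) {K : ℝ} (hK : 0 ≤ K) :
    ∃ c > 0, ∀ g : (h : Fin d) → Fin (k h) → ℝ, (∀ h j, |g h j| ≤ K) → c ≤ selectionProb ε g := by
  obtain ⟨g₀, -, h₀⟩ := (isCompact_closedBall (0 : (h : Fin d) → Fin (k h) → ℝ) K).exists_isMinOn
    ⟨0, by simpa using hK⟩ (continuous_selectionProb ε).continuousOn
  exact ⟨_, selectionProb_pos ε g₀, fun g hg => h₀ (mem_closedBall_gains hK hg)⟩

/-- Uniform continuity on the same compact ball, so that `δ` does not depend on `n` either. -/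
lemma exists_abs_selectionProb_sub_le (ε : Fin d → ℝ) {K : ℝ} (hK : 0 ≤ K) {κ : ℝ} (hκ : 0 < κ) :
    ∃ δ > 0, ∀ g g' : (h : Fin d) → Fin (k h) → ℝ, (∀ h j, |g h j| ≤ K) →
      (∀ h j, |g' h j| ≤ K) → (∀ h j, |g h j - g' h j| ≤ δ) →
        |selectionProb ε g - selectionProb ε g'| ≤ κ := by
  have h := (isCompact_closedBall
    (0 : (h : Fin d) → Fin (k h) → ℝ) K).uniformContinuousOn_of_continuous
      (continuous_selectionProb ε).continuousOn
  obtain ⟨δ, hδ, H⟩ := Metric.uniformContinuousOn_iff.1 h κ hκ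
  refine ⟨δ / 2, by positivity, fun g g' hg hg' hgg' => ?_⟩
  have h1 : dist g g' < δ := by
    refine lt_of_le_of_lt ?_ (half_lt_self hδ)
    refine (dist_pi_le_iff (by positivity)).2 fun h => ?_
    exact (dist_pi_le_iff (by positivity)).2 fun j => hgg' h j
  exact (H g (mem_closedBall_gains hK hg) g' (mem_closedBall_gains hK hg') h1).le

section Counts

variable {𝒳 : Type*} {n : ℕ} (X : Fin n → 𝒳) (y : Fin n → Bool)

/-! ## Counts, proportions and their means -/

lemma count_eq_sum (R : Set 𝒳) : (count X R : ℝ) = ∑ i, R.indicator (1 : 𝒳 → ℝ) (X i) := by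
  classical
  have h : ∀ i, R.indicator (1 : 𝒳 → ℝ) (X i) = if X i ∈ R then 1 else 0 := fun i => by
    simp [Set.indicator_apply]
  simp_rw [h]
  rw [Finset.sum_boole, count, Set.ncard_eq_toFinset_card']
  simp

lemma count_mono {R R' : Set 𝒳} (h : R ⊆ R') : count X R ≤ count X R' :=
  Set.ncard_le_ncard (fun _ hi => h hi) (Set.toFinite _)

lemma indicator_diff_apply {𝒳 : Type*} {P Q : Set 𝒳} (h : Q ⊆ P) (x : 𝒳) :
    (P \ Q).indicator (1 : 𝒳 → ℝ) x = P.indicator 1 x - Q.indicator 1 x := by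
  by_cases hQ : x ∈ Q
  · simp [hQ, h hQ]
  · by_cases hP : x ∈ P <;> simp [hQ, hP]

lemma count_diff {P Q : Set 𝒳} (h : Q ⊆ P) :
    (count X (P \ Q) : ℝ) = (count X P : ℝ) - count X Q := by
  rw [count_eq_sum, count_eq_sum, count_eq_sum, ← Finset.sum_sub_distrib]
  refine Finset.sum_congr rfl fun i _ => ?_
  exact indicator_diff_apply h _

lemma count_inter_diff {P Q : Set 𝒳} (h : Q ⊆ P) (L : Set 𝒳) :
    (count X ((P \ Q) ∩ L) : ℝ) = (count X (P ∩ L) : ℝ) - count X (Q ∩ L) := by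
  rw [← count_diff X (Set.inter_subset_inter_left L h)]
  congr 2
  ext x; simp only [Set.mem_inter_iff, Set.mem_sdiff]; tauto

/-- Holds for empty regions as well: if the count is zero, every indicator in the sum vanishes. -/
lemma count_mul_prop (R : Set 𝒳) :
    (count X R : ℝ) * prop X y R =
      ∑ i, (if y i then (1 : ℝ) else 0) * R.indicator 1 (X i) := by
  unfold prop
  rcases eq_or_ne (count X R : ℝ) 0 with h | h
  · rw [h, zero_mul, eq_comm]
    have h0 : ∀ i ∈ Finset.univ, R.indicator (1 : 𝒳 → ℝ) (X i) = 0 := by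
      rw [count_eq_sum] at h
      exact (Finset.sum_eq_zero_iff_of_nonneg fun i _ =>
        Set.indicator_nonneg (fun _ _ => zero_le_one) _).1 h
    exact Finset.sum_eq_zero fun i hi => by rw [h0 i hi, mul_zero]
  · field_simp

lemma prop_diff {P Q : Set 𝒳} (h : Q ⊆ P) :
    ((count X P : ℝ) - count X Q) * prop X y (P \ Q) =
      count X P * prop X y P - count X Q * prop X y Q := by
  rw [← count_diff X h, count_mul_prop, count_mul_prop, count_mul_prop, ← Finset.sum_sub_distrib]
  refine Finset.sum_congr rfl fun i _ => ?_
  rw [indicator_diff_apply h, mul_sub]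

/-- The mean of the proportion of ones in the region `R`. -/
def propMean (θ : 𝒳 → ℝ) (R : Set 𝒳) : ℝ :=
  (1 / (count X R : ℝ)) * ∑ i, θ (X i) * R.indicator 1 (X i)

lemma propMean_mem_Icc {θ : 𝒳 → ℝ} {a b : ℝ} (hθ : ∀ x, θ x ∈ Set.Icc a b) {R : Set 𝒳}
    (hR : 0 < count X R) : propMean X θ R ∈ Set.Icc a b := by
  have hR' : (0 : ℝ) < count X R := by exact_mod_cast hR
  have h0 : ∀ i, 0 ≤ R.indicator (1 : 𝒳 → ℝ) (X i) := fun i =>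
    Set.indicator_nonneg (fun _ _ => zero_le_one) _
  unfold propMean
  rw [one_div, ← div_eq_inv_mul]
  refine ⟨(le_div_iff₀ hR').2 ?_, (div_le_iff₀ hR').2 ?_⟩
  · rw [count_eq_sum, Finset.mul_sum]
    exact Finset.sum_le_sum fun i _ => mul_le_mul_of_nonneg_right (hθ _).1 (h0 i)
  · rw [count_eq_sum, Finset.mul_sum]
    exact Finset.sum_le_sum fun i _ => mul_le_mul_of_nonneg_right (hθ _).2 (h0 i)

lemma propMean_eq_of_eqOn {θ : 𝒳 → ℝ} {R : Set 𝒳} {p : ℝ} (hθ : ∀ x ∈ R, θ x = p)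
    (hR : 0 < count X R) : propMean X θ R = p := by
  have hR' : (0 : ℝ) < count X R := by exact_mod_cast hR
  have h : ∀ i, θ (X i) * R.indicator 1 (X i) = p * R.indicator (1 : 𝒳 → ℝ) (X i) := fun i => by
    by_cases hi : X i ∈ R
    · rw [hθ _ hi]
    · simp [hi]
  unfold propMean
  simp_rw [h]
  rw [← Finset.mul_sum, ← count_eq_sum]
  field_simp

/-- **Chebyshev's inequality** for the proportion of ones in a region. -/
lemma measureReal_abs_prop_sub_le {Ω : Type*} [MeasurableSpace Ω] {P : Measure Ω}
    [IsProbabilityMeasure P] {Y : Fin n → Ω → Bool} (hY : ∀ i, Measurable (Y i))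
    (hind : iIndepFun Y P) {θ : 𝒳 → ℝ} (hθ : ∀ i, 0 ≤ θ (X i))
    (hlaw : ∀ i, P {ω | Y i ω = true} = ENNReal.ofReal (θ (X i))) (R : Set 𝒳) {δ : ℝ}
    (hδ : 0 < δ) :
    P.real {ω | δ < |prop X (fun i => Y i ω) R - propMean X θ R|} ≤
      (δ ^ 2)⁻¹ * (count X R : ℝ)⁻¹ := by
  set ind : Fin n → ℝ := fun i => R.indicator (1 : 𝒳 → ℝ) (X i) with hindef
  have hind01 : ∀ i, ind i = 0 ∨ ind i = 1 := fun i => by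
    by_cases hi : X i ∈ R <;> simp [hindef, hi]
  set F : Fin n → Bool → ℝ := fun i b => (if b then (1 : ℝ) else 0) * ind i with hF
  have hFm : ∀ i, Measurable (F i) := fun i => measurable_of_countable _
  have hFb : ∀ i b, F i b ∈ Set.Icc (0 : ℝ) (ind i) := fun i b => by
    rcases hind01 i with h | h <;> cases b <;> simp [hF, h]
  set Z : Fin n → Ω → ℝ := fun i ω => F i (Y i ω) with hZ
  have hZm : ∀ i, Measurable (Z i) := fun i => (hFm i).comp (hY i)
  have hZL : ∀ i, MemLp (Z i) 2 P := fun i =>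
    memLp_of_bounded (ae_of_all _ fun ω => hFb i (Y i ω)) (hZm i).aestronglyMeasurable 2
  have hZind : iIndepFun Z P := hind.comp F hFm
  have hmean : ∀ i, ∫ ω, Z i ω ∂P = θ (X i) * ind i := fun i => by
    rw [hZ, integral_comp_bernoulli (hY i) (hθ i) (hlaw i) (F i)]
    simp [hF]
  -- A variable with values in `[0, ind i]` has variance at most `(ind i / 2)² ≤ ind i`, and the
  -- indicators sum to the count.
  have hvar : Var[∑ i, Z i; P] ≤ count X R := by
    rw [IndepFun.variance_sum (fun i _ => hZL i) fun i _ j _ hij => hZind.indepFun hij,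
      count_eq_sum]
    refine Finset.sum_le_sum fun i _ => ?_
    refine (variance_le_sq_of_bounded (ae_of_all _ fun ω => hFb i (Y i ω))
      (hZm i).aemeasurable).trans ?_
    change ((ind i - 0) / 2) ^ 2 ≤ ind i
    rcases hind01 i with h | h <;> rw [h] <;> norm_num
  have hprop : (fun ω => prop X (fun i => Y i ω) R) =
      fun ω => (1 / (count X R : ℝ)) * (∑ i, Z i) ω := by
    ext ω; simp [prop, hZ, hF, hindef]
  have hL2 : MemLp (fun ω => prop X (fun i => Y i ω) R) 2 P := by
    rw [hprop]
    exact (memLp_finsetSum' _ fun i _ => hZL i).const_mul _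
  have hE : ∫ ω, prop X (fun i => Y i ω) R ∂P = propMean X θ R := by
    rw [hprop, integral_const_mul]
    simp only [Finset.sum_apply]
    rw [integral_finsetSum _ fun i _ => (hZL i).integrable (by norm_num)]
    simp_rw [hmean]
    rfl
  have hV : Var[fun ω => prop X (fun i => Y i ω) R; P] ≤ (count X R : ℝ)⁻¹ := by
    rw [hprop, variance_const_mul]
    rcases eq_or_ne (count X R : ℝ) 0 with h | h
    · simp [h]
    · have h0 : 0 < (count X R : ℝ) := lt_of_le_of_ne (by positivity) h.symm
      calc (1 / (count X R : ℝ)) ^ 2 * Var[∑ i, Z i; P]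
          ≤ (1 / (count X R : ℝ)) ^ 2 * count X R := by gcongr
        _ = (count X R : ℝ)⁻¹ := by field_simp
  have hC := meas_ge_le_variance_div_sq hL2 hδ
  rw [hE] at hC
  rw [measureReal_def]
  refine ENNReal.toReal_le_of_le_ofReal (by positivity) ?_
  refine (measure_mono fun ω hω => ?_).trans (hC.trans (ENNReal.ofReal_le_ofReal ?_))
  · exact le_of_lt (Set.mem_ofPred_eq ▸ hω)
  · rw [div_eq_inv_mul]
    gcongr

end Counts

/-- Finiteness of the limsup gives `n ≤ B * c n` eventually, for a fixed natural number `B`.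
Divergence of the counts is what Chebyshev's inequality and the central limit theorem require. -/
lemma tendsto_of_limsup_div_lt_top {c : ℕ → ℕ}
    (h : limsup (fun n : ℕ => (n : ℝ≥0∞) / (c n : ℝ≥0∞)) atTop < ∞) :
    Tendsto c atTop atTop := by
  obtain ⟨b, hb, hb'⟩ := exists_between h
  have h1 := eventually_lt_of_limsup_lt hb
  obtain ⟨B, hB⟩ := exists_nat_gt b.toReal
  have hbB : b ≤ (B : ℝ≥0∞) := by
    rw [← ENNReal.ofReal_toReal hb'.ne, ← ENNReal.ofReal_natCast]
    exact ENNReal.ofReal_le_ofReal hB.le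
  have hB0 : 0 < B := by
    have : (0 : ℝ) < B := ENNReal.toReal_nonneg.trans_lt hB
    exact_mod_cast this
  refine tendsto_atTop.2 fun m => ?_
  filter_upwards [h1, eventually_ge_atTop (B * m)] with n hn hnm
  have hlt : (n : ℝ≥0∞) / c n < B := hn.trans_le hbB
  have hle : n ≤ B * c n := by
    have := (ENNReal.div_le_iff_le_mul (Or.inr (by simp)) (Or.inl (by simp))).1 hlt.le
    · exact_mod_cast this
  exact Nat.le_of_mul_le_mul_left (hnm.trans hle) hB0

/-! ## Gains as functions of three proportions -/

/-- The gain of a split as a function of the relative size `q` of the first part and of the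
proportions in the region and its two parts. -/
def gainAt (I : ℝ → ℝ) (q x y z : ℝ) : ℝ := I x - q * I y - (1 - q) * I z

/-- The mean value inequality turns the derivative bound into a Lipschitz bound. Nothing is known at
the endpoints, so the proportions must always be kept strictly inside `(0, 1)`. -/
lemma BoundedThriceDiff.exists_bound {I : ℝ → ℝ} (hI : BoundedThriceDiff I) :
    ContinuousOn I (Set.Ioo 0 1) ∧ ∃ C : ℝ, 0 ≤ C ∧ (∀ x ∈ Set.Ioo (0 : ℝ) 1, |I x| ≤ C) ∧
      ∀ x ∈ Set.Ioo (0 : ℝ) 1, ∀ y ∈ Set.Ioo (0 : ℝ) 1, |I x - I y| ≤ C * |x - y| := by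
  obtain ⟨hd, C, hC⟩ := hI
  have hd0 : DifferentiableOn ℝ I (Set.Ioo 0 1) := by simpa using hd 0 (by norm_num)
  have hC0 : ∀ x ∈ Set.Ioo (0 : ℝ) 1, |I x| ≤ C := by simpa using hC 0 (by norm_num)
  have hC1 : ∀ x ∈ Set.Ioo (0 : ℝ) 1, |deriv I x| ≤ C := by simpa using hC 1 (by norm_num)
  refine ⟨hd0.continuousOn, C, ?_, hC0, fun x hx y hy => ?_⟩
  · exact (abs_nonneg _).trans (hC0 (1 / 2) (by norm_num))
  · have h := (convex_Ioo (0 : ℝ) 1).norm_image_sub_le_of_norm_deriv_le (f := I) (C := C)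
      (fun z hz => hd0.differentiableAt (isOpen_Ioo.mem_nhds hz)) (fun z hz => hC1 z hz) hy hx
    simpa using h

lemma abs_gainAt_le {I : ℝ → ℝ} {C : ℝ} (hC : ∀ x ∈ Set.Ioo (0 : ℝ) 1, |I x| ≤ C) {q x y z : ℝ}
    (hq : q ∈ Set.Icc (0 : ℝ) 1) (hx : x ∈ Set.Ioo (0 : ℝ) 1) (hy : y ∈ Set.Ioo (0 : ℝ) 1)
    (hz : z ∈ Set.Ioo (0 : ℝ) 1) : |gainAt I q x y z| ≤ 2 * C := by
  have h1 := abs_le.1 (hC x hx)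
  have h2 := abs_le.1 (hC y hy)
  have h3 := abs_le.1 (hC z hz)
  unfold gainAt
  rw [abs_le]
  constructor <;> nlinarith [hq.1, hq.2]

/-- The weights `q` and `1 - q` add up to one, so the two parts together contribute one `C * δ` and
the region itself another. -/
lemma abs_gainAt_sub_le {I : ℝ → ℝ} {C δ : ℝ} (hC0 : 0 ≤ C)
    (hC : ∀ x ∈ Set.Ioo (0 : ℝ) 1, ∀ y ∈ Set.Ioo (0 : ℝ) 1, |I x - I y| ≤ C * |x - y|)
    {q x y z x' y' z' : ℝ} (hq : q ∈ Set.Icc (0 : ℝ) 1) (hx : x ∈ Set.Ioo (0 : ℝ) 1)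
    (hy : y ∈ Set.Ioo (0 : ℝ) 1) (hz : z ∈ Set.Ioo (0 : ℝ) 1) (hx' : x' ∈ Set.Ioo (0 : ℝ) 1)
    (hy' : y' ∈ Set.Ioo (0 : ℝ) 1) (hz' : z' ∈ Set.Ioo (0 : ℝ) 1) (hxx : |x - x'| ≤ δ)
    (hyy : |y - y'| ≤ δ) (hzz : |z - z'| ≤ δ) :
    |gainAt I q x y z - gainAt I q x' y' z'| ≤ 2 * (C * δ) := by
  have h1 := abs_le.1 ((hC x hx x' hx').trans (mul_le_mul_of_nonneg_left hxx hC0))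
  have h2 := abs_le.1 ((hC y hy y' hy').trans (mul_le_mul_of_nonneg_left hyy hC0))
  have h3 := abs_le.1 ((hC z hz z' hz').trans (mul_le_mul_of_nonneg_left hzz hC0))
  unfold gainAt
  rw [abs_le]
  constructor <;> nlinarith [hq.1, hq.2]

section Gains

variable {𝒳 : Type*} {n : ℕ} (X : Fin n → 𝒳) (y : Fin n → Bool)

/-- For an empty `P` both relative sizes would be `0` by convention and would not add up to one;
hence the positivity hypothesis. -/
lemma gain_eq_gainAt (I : ℝ → ℝ) {P Q : Set 𝒳} (h : Q ⊆ P) (hP : 0 < count X P) :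
    gain I X y P Q = gainAt I ((count X Q : ℝ) / count X P) (prop X y P) (prop X y Q)
      (prop X y (P \ Q)) := by
  have hP' : (count X P : ℝ) ≠ 0 := by exact_mod_cast hP.ne'
  have h1 : (1 : ℝ) - (count X Q : ℝ) / count X P = (count X (P \ Q) : ℝ) / count X P := by
    rw [count_diff X h]; field_simp
  unfold gain gainAt
  rw [h1]; ring

lemma relSize_mem_Icc {P Q : Set 𝒳} (h : Q ⊆ P) :
    (count X Q : ℝ) / count X P ∈ Set.Icc (0 : ℝ) 1 :=
  ⟨by positivity, div_le_one_of_le₀ (by exact_mod_cast count_mono X h) (by positivity)⟩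

end Gains

section Lines

variable {𝒳 : Type*} {d m : ℕ} {k : Fin d → ℕ} [NeZero m] [∀ h, NeZero (k h)]
  (t : TreeFit 𝒳 d m k) {n : ℕ} (X : Fin n → 𝒳) (y : Fin n → Bool)

/-! ## The proportions as affine functions of the main statistic -/

/-- Solved for the proportion, this expresses it through the orthogonalized and the main statistic;
the coefficient of `mainStat` is the slope when that statistic becomes a free variable. -/
lemma orthStat_div_sqrt {R : Set 𝒳} (hR : 0 < count X R) (hL : 0 < count X (t.leaf 0)) :
    orthStat t X y R / √(count X R) = prop X y R -
      (count X (R ∩ t.leaf 0) : ℝ) / (count X R * √(count X (t.leaf 0))) * mainStat t X y := by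
  have hR' : (0 : ℝ) < count X R := by exact_mod_cast hR
  have hL' : (0 : ℝ) < count X (t.leaf 0) := by exact_mod_cast hL
  unfold orthStat mainStat
  rw [Real.sqrt_mul hL'.le]
  have h1 : 0 < √(count X R : ℝ) := Real.sqrt_pos.2 hR'
  have h2 : 0 < √(count X (t.leaf 0) : ℝ) := Real.sqrt_pos.2 hL'
  have h3 : (count X R : ℝ) = √(count X R : ℝ) * √(count X R : ℝ) := (Real.mul_self_sqrt hR'.le).symm
  rw [sub_div, mul_div_cancel_left₀ _ h1.ne']
  congr 1
  generalize √(count X R : ℝ) = r at h1 h3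
  rw [h3]
  field_simp

lemma leaf_subset_node (i : Fin (d + 1)) : t.leaf 0 ⊆ t.node i := by
  induction i using Fin.reverseInduction with
  | last => exact t.node_last.ge
  | cast h ih => exact (ih.trans (t.child_zero h).ge).trans (t.child_subset h 0)

/-- Orthogonalizing the first leaf against itself gives zero, which matches the default value at the
end of the path. -/
lemma nodeCoord_nuisStat (i : Fin (d + 1)) :
    nodeCoord (nuisStat t X y) i = orthStat t X y (t.node i) := by
  induction i using Fin.lastCases with
  | last =>
    rw [nodeCoord, Fin.lastCases_last, t.node_last, orthStat, Set.inter_self]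
    rcases eq_or_ne (count X (t.leaf 0) : ℝ) 0 with h | h
    · simp [h]
    · rw [Real.sqrt_mul_self (by positivity), div_self h]
      ring
  | cast h =>
    rw [nodeCoord, Fin.lastCases_castSucc]
    simp [nuisStat, TreeFit.region]

lemma splitArgs_nuisStat (u : ℝ) (h : Fin d) (j : Fin (k h)) :
    splitArgs u (nuisStat t X y) h j =
      (u, orthStat t X y (t.node h.castSucc), orthStat t X y (t.child h j)) := by
  unfold splitArgs
  rw [nodeCoord_nuisStat, nodeCoord_nuisStat]
  split_ifs with hj
  · rw [hj, t.child_zero]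
  · simp [nuisStat, TreeFit.region, hj]

variable {P Q : Set 𝒳}

/-- With the nuisance statistics frozen, each recovered proportion is affine in `u` and passes
through the observed proportion at `u = mainStat`. The next two lemmas do the same for the two parts
of the split. -/
lemma eta_line_node (hLP : t.leaf 0 ⊆ P) (hL : 0 < count X (t.leaf 0)) (u : ℝ) :
    eta X (t.leaf 0) P Q 0 * u + eta X (t.leaf 0) P Q 1 * orthStat t X y P =
      prop X y P + eta X (t.leaf 0) P Q 0 * (u - mainStat t X y) := by
  have h := orthStat_div_sqrt t X y (hL.trans_le (count_mono X hLP)) hL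
  have hL' : (0 : ℝ) < count X (t.leaf 0) := by exact_mod_cast hL
  have h1 : (count X (P ∩ t.leaf 0) : ℝ) / (count X P * √(count X (t.leaf 0))) =
      √(count X (t.leaf 0)) / count X P := by
    rw [Set.inter_eq_right.2 hLP, mul_comm, ← div_div, Real.div_sqrt]
  rw [h1] at h
  simp only [eta, Matrix.cons_val_zero, Matrix.cons_val_one]
  rw [one_div, inv_mul_eq_div, h]
  ring

lemma eta_line_child (hQ : 0 < count X Q) (hL : 0 < count X (t.leaf 0)) (u : ℝ) :
    eta X (t.leaf 0) P Q 2 * u + eta X (t.leaf 0) P Q 3 * orthStat t X y Q =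
      prop X y Q + eta X (t.leaf 0) P Q 2 * (u - mainStat t X y) := by
  have h := orthStat_div_sqrt t X y hQ hL
  simp only [eta, Matrix.cons_val]
  rw [one_div, inv_mul_eq_div, h]
  ring

lemma eta_line_compl (hQP : Q ⊆ P) (hLP : t.leaf 0 ⊆ P) (hQ : 0 < count X Q)
    (hPQ : 0 < count X (P \ Q)) (hL : 0 < count X (t.leaf 0)) (u : ℝ) :
    eta X (t.leaf 0) P Q 4 * u + eta X (t.leaf 0) P Q 5 * orthStat t X y P +
        eta X (t.leaf 0) P Q 6 * orthStat t X y Q =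
      prop X y (P \ Q) + eta X (t.leaf 0) P Q 4 * (u - mainStat t X y) := by
  have hPpos := hL.trans_le (count_mono X hLP)
  have hP' : (0 : ℝ) < count X P := by exact_mod_cast hPpos
  have hQ' : (0 : ℝ) < count X Q := by exact_mod_cast hQ
  have hL' : (0 : ℝ) < count X (t.leaf 0) := by exact_mod_cast hL
  have hD : (0 : ℝ) < (count X P : ℝ) - count X Q := by
    rw [← count_diff X hQP]; exact_mod_cast hPQ
  have h1 := orthStat_div_sqrt t X y hPpos hL
  have h2 := orthStat_div_sqrt t X y hQ hL
  have h3 := prop_diff X y hQP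
  rw [div_eq_iff (Real.sqrt_pos.2 hP').ne'] at h1
  rw [div_eq_iff (Real.sqrt_pos.2 hQ').ne'] at h2
  have h4 : prop X y (P \ Q) =
      (count X P * prop X y P - count X Q * prop X y Q) / ((count X P : ℝ) - count X Q) := by
    rw [eq_div_iff hD.ne', mul_comm, h3]
  have h5 : ∀ {N : ℝ}, 0 ≤ N → ∀ D x : ℝ, √N / D * (x * √N) = N * x / D := fun hN D x => by
    rw [div_mul_eq_mul_div, mul_left_comm, Real.mul_self_sqrt hN, mul_comm x]
  simp only [eta, Matrix.cons_val]
  rw [h1, h2, h4, neg_mul, h5 hP'.le, h5 hQ'.le]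
  have hs : 0 < √(count X (t.leaf 0) : ℝ) := Real.sqrt_pos.2 hL'
  generalize √(count X (t.leaf 0) : ℝ) = s at hs
  generalize hDD : (count X P : ℝ) - count X Q = D at hD
  field_simp
  ring

/-- Slopes are at most `1 / √n₁`, because a region contains at least as many sample points as its
intersection with the first leaf. This is why a bounded change of `u` has asymptotically no effect
on the gains. -/
lemma eta_slope_node (hLP : t.leaf 0 ⊆ P) :
    |eta X (t.leaf 0) P Q 0| * √(count X (t.leaf 0)) ≤ 1 := by
  simp only [eta, Matrix.cons_val_zero]
  rw [abs_of_nonneg (by positivity), div_mul_eq_mul_div, Real.mul_self_sqrt (by positivity)]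
  exact (relSize_mem_Icc X hLP).2

lemma div_mul_sqrt_mul_sqrt_le {r c l : ℝ} (hr : 0 ≤ r) (hrc : r ≤ c) :
    |r / (c * √l)| * √l ≤ 1 := by
  have hc : 0 ≤ c := hr.trans hrc
  rw [abs_of_nonneg (by positivity), div_mul_eq_mul_div]
  exact div_le_one_of_le₀ (by gcongr) (by positivity)

lemma eta_slope_child : |eta X (t.leaf 0) P Q 2| * √(count X (t.leaf 0)) ≤ 1 := by
  simp only [eta, Matrix.cons_val]
  exact div_mul_sqrt_mul_sqrt_le (by positivity)
    (by exact_mod_cast count_mono X Set.inter_subset_left)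

lemma eta_slope_compl (hQP : Q ⊆ P) :
    |eta X (t.leaf 0) P Q 4| * √(count X (t.leaf 0)) ≤ 1 := by
  simp only [eta, Matrix.cons_val]
  rw [← count_diff X hQP, ← count_inter_diff X hQP]
  exact div_mul_sqrt_mul_sqrt_le (by positivity)
    (by exact_mod_cast count_mono X Set.inter_subset_left)

end Lines

section Tree

variable {𝒳 : Type*} {d m : ℕ} {k : Fin d → ℕ} [NeZero m] [∀ h, NeZero (k h)]
  (t : TreeFit 𝒳 d m k) {n : ℕ} (X : Fin n → 𝒳) (y : Fin n → Bool)

/-! ## The regions of the path -/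

/-- The family of all regions whose proportions enter the gains along the path, together with the
first leaf. -/
def TreeFit.pathRegion : Option (NuisIdx k × Fin 3) → Set 𝒳
  | none => t.leaf 0
  | some (a, 0) => t.node a.1.castSucc
  | some (a, 1) => t.child a.1 a.2
  | some (a, 2) => t.node a.1.castSucc \ t.child a.1 a.2

lemma TreeFit.theta_eq (π : Fin m → ℝ) {x : 𝒳} {j : Fin m} (hx : x ∈ t.leaf j) :
    t.theta π x = π j := by
  unfold TreeFit.theta
  rw [Finset.sum_eq_single j]
  · simp [hx]
  · intro i _ hij
    have : x ∉ t.leaf i := fun hi => Set.disjoint_left.1 (t.leaf_disjoint hij) hi hx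
    simp [this]
  · simp

lemma TreeFit.theta_mem {π : Fin m → ℝ} {s : Set ℝ} (hπ : ∀ j, π j ∈ s) (x : 𝒳) :
    t.theta π x ∈ s := by
  have hx : x ∈ ⋃ j, t.leaf j := t.leaf_cover ▸ Set.mem_univ x
  obtain ⟨j, hj⟩ := Set.mem_iUnion.1 hx
  rw [t.theta_eq π hj]
  exact hπ j

/-! ## Selection probabilities on the event that all proportions are close to their means -/

/-- The gain of a candidate split at the means of the proportions. -/
def meanGain (I : ℝ → ℝ) (θ : 𝒳 → ℝ) (h : Fin d) (j : Fin (k h)) : ℝ :=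
  gainAt I ((count X (t.child h j) : ℝ) / count X (t.node h.castSucc))
    (propMean X θ (t.node h.castSucc)) (propMean X θ (t.child h j))
    (propMean X θ (t.node h.castSucc \ t.child h j))

lemma mem_Ioo_of_abs_sub_le {x c a δ : ℝ} (hc : c ∈ Set.Icc a (1 - a)) (h : |x - c| ≤ δ)
    (hδ : δ < a) : x ∈ Set.Ioo (0 : ℝ) 1 := by
  have := abs_le.1 h
  exact ⟨by linarith [hc.1], by linarith [hc.2]⟩

variable {t X y}

/-- One `δ` comes from the distance of `u` to the mean of the main statistic (at most `M ≤ δ √n₁`),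
the other from the distance of the observed statistic to that mean. -/
lemma abs_slope_mul_sub_mainStat_le {θ : 𝒳 → ℝ} {δ M u s : ℝ}
    (hdev : |prop X y (t.leaf 0) - propMean X θ (t.leaf 0)| ≤ δ)
    (hM : M ≤ δ * √(count X (t.leaf 0)))
    (hu : |u - √(count X (t.leaf 0)) * propMean X θ (t.leaf 0)| ≤ M)
    (hs : |s| * √(count X (t.leaf 0)) ≤ 1) : |s * (u - mainStat t X y)| ≤ 2 * δ := by
  have hδ : 0 ≤ δ := (abs_nonneg _).trans hdev
  have hsplit : s * (u - mainStat t X y) =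
      s * (u - √(count X (t.leaf 0)) * propMean X θ (t.leaf 0)) -
        s * (√(count X (t.leaf 0)) * (prop X y (t.leaf 0) - propMean X θ (t.leaf 0))) := by
    unfold mainStat; ring
  rw [hsplit]
  refine (abs_sub _ _).trans ?_
  rw [abs_mul, abs_mul, abs_mul, abs_of_nonneg (Real.sqrt_nonneg _)]
  have h1 : |s| * |u - √(count X (t.leaf 0)) * propMean X θ (t.leaf 0)| ≤ δ := by
    calc _ ≤ |s| * (δ * √(count X (t.leaf 0))) := by gcongr; exact hu.trans hM
      _ = δ * (|s| * √(count X (t.leaf 0))) := by ring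
      _ ≤ δ * 1 := by gcongr
      _ = δ := mul_one δ
  have h2 : |s| * (√(count X (t.leaf 0)) *
      |prop X y (t.leaf 0) - propMean X θ (t.leaf 0)|) ≤ δ := by
    rw [← mul_assoc]
    calc _ ≤ 1 * δ := by gcongr
      _ = δ := one_mul δ
  linarith

/-- If all proportions are `δ`-close to their means, then the proportions recovered from a
value `u` of the main statistic near the observed one lie in `(0, 1)`, and the resulting gains are
close to the gains at the means. -/
lemma mem_statDomain_and_abs_gainMap_sub_le {I : ℝ → ℝ} {C a δ u : ℝ} {θ : 𝒳 → ℝ} (hC0 : 0 ≤ C)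
    (hCI : ∀ x ∈ Set.Ioo (0 : ℝ) 1, |I x| ≤ C)
    (hCL : ∀ x ∈ Set.Ioo (0 : ℝ) 1, ∀ y ∈ Set.Ioo (0 : ℝ) 1, |I x - I y| ≤ C * |x - y|)
    (hpos : ∀ r, 0 < count X (t.pathRegion r))
    (hmean : ∀ r, propMean X θ (t.pathRegion r) ∈ Set.Icc a (1 - a))
    (hdev : ∀ r, |prop X y (t.pathRegion r) - propMean X θ (t.pathRegion r)| ≤ δ)
    (hδa : 3 * δ < a)
    (hu : ∀ s : ℝ, |s| * √(count X (t.leaf 0)) ≤ 1 → |s * (u - mainStat t X y)| ≤ 2 * δ) :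
    (u, nuisStat t X y) ∈ statDomain t X ∧ ∀ h j,
      |gainMap I (splitEta t X h j) (splitArgs u (nuisStat t X y) h j)| ≤ 2 * C ∧
      |gainMap I (splitEta t X h j) (splitArgs u (nuisStat t X y) h j) - meanGain t X I θ h j| ≤
        2 * (C * (3 * δ)) := by
  have hδ : 0 ≤ δ := (abs_nonneg _).trans (hdev none)
  have hL : 0 < count X (t.leaf 0) := hpos none
  -- `3 * δ` is `δ` for the observed proportion and `2 * δ` for the movement along the line.
  have close : ∀ r s, |s| * √(count X (t.leaf 0)) ≤ 1 →
      |prop X y (t.pathRegion r) + s * (u - mainStat t X y) - propMean X θ (t.pathRegion r)| ≤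
        3 * δ := fun r s hs => by
    have h1 := abs_le.1 (hdev r)
    have h2 := abs_le.1 (hu s hs)
    rw [abs_le]; constructor <;> linarith
  have mean_mem : ∀ r, propMean X θ (t.pathRegion r) ∈ Set.Ioo (0 : ℝ) 1 := fun r =>
    mem_Ioo_of_abs_sub_le (hmean r) (δ := 3 * δ) (by simpa using hδ) hδa
  have key : ∀ h (j : Fin (k h)),
      splitArgs u (nuisStat t X y) h j ∈ gainDomain (splitEta t X h j) ∧
      |gainMap I (splitEta t X h j) (splitArgs u (nuisStat t X y) h j)| ≤ 2 * C ∧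
      |gainMap I (splitEta t X h j) (splitArgs u (nuisStat t X y) h j) - meanGain t X I θ h j| ≤
        2 * (C * (3 * δ)) := by
    intro h j
    have hLP := leaf_subset_node t h.castSucc
    have hQP := t.child_subset h j
    have hQ : 0 < count X (t.child h j) := hpos (some (⟨h, j⟩, 1))
    have hPQ : 0 < count X (t.node h.castSucc \ t.child h j) := hpos (some (⟨h, j⟩, 2))
    have e1 := eta_line_node t X y (Q := t.child h j) hLP hL u
    have e2 := eta_line_child t X y (P := t.node h.castSucc) hQ hL u
    have e3 := eta_line_compl t X y hQP hLP hQ hPQ hL u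
    have c1 := close (some (⟨h, j⟩, 0)) _ (eta_slope_node t X (Q := t.child h j) hLP)
    have c2 := close (some (⟨h, j⟩, 1)) _ (eta_slope_child t X (P := t.node h.castSucc)
      (Q := t.child h j))
    have c3 := close (some (⟨h, j⟩, 2)) _ (eta_slope_compl t X hQP)
    have i1 := mem_Ioo_of_abs_sub_le (hmean (some (⟨h, j⟩, 0))) c1 hδa
    have i2 := mem_Ioo_of_abs_sub_le (hmean (some (⟨h, j⟩, 1))) c2 hδa
    have i3 := mem_Ioo_of_abs_sub_le (hmean (some (⟨h, j⟩, 2))) c3 hδa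
    have hq := relSize_mem_Icc X hQP
    have hg : gainMap I (splitEta t X h j) (splitArgs u (nuisStat t X y) h j) =
        gainAt I ((count X (t.child h j) : ℝ) / count X (t.node h.castSucc))
          (prop X y (t.node h.castSucc) +
            eta X (t.leaf 0) (t.node h.castSucc) (t.child h j) 0 * (u - mainStat t X y))
          (prop X y (t.child h j) +
            eta X (t.leaf 0) (t.node h.castSucc) (t.child h j) 2 * (u - mainStat t X y))
          (prop X y (t.node h.castSucc \ t.child h j) +
            eta X (t.leaf 0) (t.node h.castSucc) (t.child h j) 4 * (u - mainStat t X y)) := by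
      rw [splitArgs_nuisStat]
      unfold gainMap splitEta
      simp only
      rw [e1, e2, e3]
      rfl
    refine ⟨?_, ?_, ?_⟩
    · rw [splitArgs_nuisStat]
      unfold gainDomain splitEta
      simp only [Set.mem_ofPred_eq]
      rw [e1, e2, e3]
      exact ⟨i1, i2, i3⟩
    · rw [hg]
      exact abs_gainAt_le hCI hq i1 i2 i3
    · rw [hg]
      exact abs_gainAt_sub_le hC0 hCL hq i1 i2 i3 (mean_mem (some (⟨h, j⟩, 0)))
        (mean_mem (some (⟨h, j⟩, 1))) (mean_mem (some (⟨h, j⟩, 2))) c1 c2 c3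
  exact ⟨fun h j => (key h j).1, fun h j => (key h j).2⟩

lemma abs_meanGain_le {I : ℝ → ℝ} {C a : ℝ} {θ : 𝒳 → ℝ} (ha : 0 < a)
    (hCI : ∀ x ∈ Set.Ioo (0 : ℝ) 1, |I x| ≤ C)
    (hmean : ∀ r, propMean X θ (t.pathRegion r) ∈ Set.Icc a (1 - a)) (h : Fin d)
    (j : Fin (k h)) : |meanGain t X I θ h j| ≤ 2 * C := by
  have mean_mem : ∀ r, propMean X θ (t.pathRegion r) ∈ Set.Ioo (0 : ℝ) 1 := fun r =>
    mem_Ioo_of_abs_sub_le (hmean r) (δ := 0) (by simp) ha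
  exact abs_gainAt_le hCI (relSize_mem_Icc X (t.child_subset h j)) (mean_mem (some (⟨h, j⟩, 0)))
    (mean_mem (some (⟨h, j⟩, 1))) (mean_mem (some (⟨h, j⟩, 2)))

lemma prod_splitProb_eq (I : ℝ → ℝ) (ε : Fin d → ℝ) :
    ∏ h, splitProb I (ε h) X y (t.node h.castSucc) (t.child h) 0 =
      selectionProb ε fun h j => gain I X y (t.node h.castSucc) (t.child h j) := rfl

lemma prod_lambda_eq {I : ℝ → ℝ} {ε : Fin d → ℝ} {u : ℝ} {v : NuisIdx k → ℝ}
    (h : (u, v) ∈ statDomain t X) :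
    ∏ h, lambda I ε t X h u v =
      selectionProb ε fun h j => gainMap I (splitEta t X h j) (splitArgs u v h j) := by
  refine Finset.prod_congr rfl fun i _ => ?_
  rw [lambda, if_pos h]

lemma lambda_nonneg (I : ℝ → ℝ) (ε : Fin d → ℝ) (h : Fin d) (u : ℝ) (v : NuisIdx k → ℝ) :
    0 ≤ lambda I ε t X h u v := by
  unfold lambda
  split_ifs <;> positivity

lemma lambda_le_one (I : ℝ → ℝ) (ε : Fin d → ℝ) (h : Fin d) (u : ℝ) (v : NuisIdx k → ℝ) :
    lambda I ε t X h u v ≤ 1 := by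
  unfold lambda
  split_ifs
  · refine div_le_one_of_le₀ ?_ (by positivity)
    exact Finset.single_le_sum
      (f := fun j => Real.exp (ε h * gainMap I (splitEta t X h j) (splitArgs u v h j)))
      (fun _ _ => (Real.exp_pos _).le) (Finset.mem_univ 0)
  · exact zero_le_one

/-- In `u` the domain is open and the formula is continuous on it, while the value outside is
constant; `I` need not be measurable elsewhere. -/
lemma measurable_lambda {I : ℝ → ℝ} (hI : ContinuousOn I (Set.Ioo 0 1)) (ε : Fin d → ℝ)
    (h : Fin d) (v : NuisIdx k → ℝ) : Measurable fun u => lambda I ε t X h u v := by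
  set D : Set ℝ := {u | (u, v) ∈ statDomain t X} with hD
  have hDo : IsOpen D := by
    have : D = ⋂ h, ⋂ j, {u | splitArgs u v h j ∈ gainDomain (splitEta t X h j)} := by
      ext u; simp [hD, statDomain]
    rw [this]
    refine isOpen_iInter_of_finite fun h => isOpen_iInter_of_finite fun j => ?_
    refine IsOpen.inter ?_ (IsOpen.inter ?_ ?_)
    all_goals exact isOpen_Ioo.preimage (by unfold splitArgs; fun_prop)
  have hg : ∀ j, ContinuousOn
      (fun u => gainMap I (splitEta t X h j) (splitArgs u v h j)) D := by
    intro j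
    refine ContinuousOn.sub (ContinuousOn.sub ?_ (continuousOn_const.mul ?_))
      (continuousOn_const.mul ?_)
    · exact hI.comp (by unfold splitArgs; fun_prop) fun u hu => (hu h j).1
    · exact hI.comp (by unfold splitArgs; fun_prop) fun u hu => (hu h j).2.1
    · exact hI.comp (by unfold splitArgs; fun_prop) fun u hu => (hu h j).2.2
  have hf : ContinuousOn (fun u =>
      Real.exp (ε h * gainMap I (splitEta t X h 0) (splitArgs u v h 0)) /
        ∑ j, Real.exp (ε h * gainMap I (splitEta t X h j) (splitArgs u v h j))) D := by
    refine ContinuousOn.div ?_ ?_ fun u _ =>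
      (Finset.sum_pos (fun _ _ => Real.exp_pos _) Finset.univ_nonempty).ne'
    · exact Real.continuous_exp.comp_continuousOn (continuousOn_const.mul (hg 0))
    · exact continuousOn_finsetSum _ fun j _ =>
        Real.continuous_exp.comp_continuousOn (continuousOn_const.mul (hg j))
  classical
  have := ContinuousOn.measurable_piecewise (f := fun u =>
      Real.exp (ε h * gainMap I (splitEta t X h 0) (splitArgs u v h 0)) /
        ∑ j, Real.exp (ε h * gainMap I (splitEta t X h j) (splitArgs u v h j)))
    (g := fun _ => 0) hf continuousOn_const hDo.measurableSet
  convert this using 2 with u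
  simp only [lambda, Set.piecewise, hD, Set.mem_ofPred_eq]

/-- If all proportions are `δ`-close to their means, then the conditional selection probability is
close to a constant, and the pivot is close to the normal distribution function. -/
lemma abs_selectionProb_sub_and_abs_pivot_sub_le {I : ℝ → ℝ} {ε : Fin d → ℝ}
    {C a δ δ₁ κ c M p : ℝ} {θ : 𝒳 → ℝ} (hIc : ContinuousOn I (Set.Ioo 0 1)) (hC0 : 0 ≤ C)
    (hCI : ∀ x ∈ Set.Ioo (0 : ℝ) 1, |I x| ≤ C)
    (hCL : ∀ x ∈ Set.Ioo (0 : ℝ) 1, ∀ y ∈ Set.Ioo (0 : ℝ) 1, |I x - I y| ≤ C * |x - y|)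
    (hc : 0 < c) (hcε : ∀ g : (h : Fin d) → Fin (k h) → ℝ, (∀ h j, |g h j| ≤ 2 * C) →
      c ≤ selectionProb ε g)
    (hκ : 0 ≤ κ)
    (hκε : ∀ g g' : (h : Fin d) → Fin (k h) → ℝ, (∀ h j, |g h j| ≤ 2 * C) →
      (∀ h j, |g' h j| ≤ 2 * C) → (∀ h j, |g h j - g' h j| ≤ δ₁) →
        |selectionProb ε g - selectionProb ε g'| ≤ κ)
    (hpos : ∀ r, 0 < count X (t.pathRegion r))
    (hmean : ∀ r, propMean X θ (t.pathRegion r) ∈ Set.Icc a (1 - a))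
    (hdev : ∀ r, |prop X y (t.pathRegion r) - propMean X θ (t.pathRegion r)| ≤ δ)
    (hδa : 3 * δ < a) (hδ₁ : 2 * (C * (3 * δ)) ≤ δ₁) (hM0 : 0 < M)
    (hM : M ≤ δ * √(count X (t.leaf 0))) (hp : propMean X θ (t.leaf 0) = p)
    (hp01 : p ∈ Set.Ioo (0 : ℝ) 1) :
    |selectionProb ε (fun h j => gain I X y (t.node h.castSucc) (t.child h j)) -
        selectionProb ε (meanGain t X I θ)| ≤ κ ∧
      |pivot I ε t X p y - cdf (gaussianReal 0 1)
        ((√(p * (1 - p)))⁻¹ * (mainStat t X y - √(count X (t.leaf 0)) * p))| ≤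
          2 * (κ + 1 / M ^ 2) / c := by
  have hδ : 0 ≤ δ := (abs_nonneg _).trans (hdev none)
  have ha : 0 < a := by linarith
  have hmg : ∀ h j, |meanGain t X I θ h j| ≤ 2 * C := abs_meanGain_le ha hCI hmean
  have dom : ∀ u, |u - √(count X (t.leaf 0)) * p| ≤ M →
      (u, nuisStat t X y) ∈ statDomain t X ∧
        |∏ h, lambda I ε t X h u (nuisStat t X y) - selectionProb ε (meanGain t X I θ)| ≤ κ := by
    intro u hu
    obtain ⟨h1, h2⟩ := mem_statDomain_and_abs_gainMap_sub_le hC0 hCI hCL hpos hmean hdev hδa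
      (u := u) fun s hs => abs_slope_mul_sub_mainStat_le (hdev none) hM (by rwa [hp]) hs
    refine ⟨h1, ?_⟩
    rw [prod_lambda_eq h1]
    exact hκε _ _ (fun h j => (h2 h j).1) hmg fun h j => (h2 h j).2.trans hδ₁
  -- At the observed value the displacement is zero, so the pivot is given by the quotient of
  -- integrals and not by its default value.
  have domT : (mainStat t X y, nuisStat t X y) ∈ statDomain t X :=
    (mem_statDomain_and_abs_gainMap_sub_le hC0 hCI hCL hpos hmean hdev hδa
      (u := mainStat t X y) fun s _ => by rw [sub_self, mul_zero, abs_zero]; positivity).1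
  constructor
  · have hI01 : ∀ r, prop X y (t.pathRegion r) ∈ Set.Ioo (0 : ℝ) 1 := fun r =>
      mem_Ioo_of_abs_sub_le (hmean r) (hdev r) (by linarith)
    have hm01 : ∀ r, propMean X θ (t.pathRegion r) ∈ Set.Ioo (0 : ℝ) 1 := fun r =>
      mem_Ioo_of_abs_sub_le (hmean r) (δ := 0) (by simp) ha
    have hg : ∀ h (j : Fin (k h)), gain I X y (t.node h.castSucc) (t.child h j) = _ := fun h j =>
      gain_eq_gainAt X y I (t.child_subset h j) (hpos (some (⟨h, j⟩, 0)))
    refine hκε _ _ (fun h j => ?_) hmg fun h j => ?_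
    · rw [hg]
      exact abs_gainAt_le hCI (relSize_mem_Icc X (t.child_subset h j)) (hI01 (some (⟨h, j⟩, 0)))
        (hI01 (some (⟨h, j⟩, 1))) (hI01 (some (⟨h, j⟩, 2)))
    · rw [hg]
      refine (abs_gainAt_sub_le (δ := 3 * δ) hC0 hCL (relSize_mem_Icc X (t.child_subset h j))
        (hI01 (some (⟨h, j⟩, 0))) (hI01 (some (⟨h, j⟩, 1))) (hI01 (some (⟨h, j⟩, 2)))
        (hm01 (some (⟨h, j⟩, 0))) (hm01 (some (⟨h, j⟩, 1))) (hm01 (some (⟨h, j⟩, 2)))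
        ((hdev (some (⟨h, j⟩, 0))).trans ?_) ((hdev (some (⟨h, j⟩, 1))).trans ?_)
        ((hdev (some (⟨h, j⟩, 2))).trans ?_)).trans hδ₁ <;> linarith
  · have hv : 0 < p * (1 - p) := mul_pos hp01.1 (by linarith [hp01.2])
    have hv1 : p * (1 - p) ≤ 1 := by nlinarith [hp01.1, hp01.2]
    have hw := hcε _ hmg
    rw [pivot, pivotFun, if_pos domT, ← integral_Iic_gaussianPDFReal _ hv]
    unfold pivotDensity
    have hψ : Measurable fun u => ∏ h, lambda I ε t X h u (nuisStat t X y) :=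
      Finset.measurable_fun_prod _ fun h _ => measurable_lambda hIc ε h _
    refine (abs_reweighted_cdf_sub_le (by simpa using hv) hψ
      (fun u => Finset.prod_nonneg fun h _ => lambda_nonneg I ε h u _)
      (fun u => Finset.prod_le_one (fun h _ => lambda_nonneg I ε h u _)
        fun h _ => lambda_le_one I ε h u _)
      (hc.trans_le hw) (selectionProb_le_one ε _) hκ hM0 (fun u hu => (dom u hu).2) _).trans ?_
    rw [Real.coe_toNNReal _ hv.le]
    -- Uses `p * (1 - p) ≤ 1` in the tail term and `c ≤ w` in the denominator.
    gcongr

end Tree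

/-! ## The law of the outcomes given the splits -/

/-- Integration over an event whose conditional probability given the finite variable `Y` is
`w Y`. -/
lemma setIntegral_comp_eq_integral_mul {Ω β : Type*} [MeasurableSpace Ω] {P : Measure Ω}
    [IsFiniteMeasure P] [MeasurableSpace β] [Finite β] [MeasurableSingletonClass β] {Y : Ω → β}
    (hY : Measurable Y) {A : Set Ω} {w : β → ℝ}
    (h : ∀ b, P.real (Y ⁻¹' {b} ∩ A) = P.real (Y ⁻¹' {b}) * w b) (g : β → ℝ) :
    ∫ ω in A, g (Y ω) ∂P = ∫ ω, g (Y ω) * w (Y ω) ∂P := by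
  have := Fintype.ofFinite β
  rw [← integral_map (φ := Y) (f := g) hY.aemeasurable .of_discrete,
    ← integral_map (φ := Y) (f := fun b => g b * w b) hY.aemeasurable .of_discrete,
    integral_fintype .of_finite, integral_fintype .of_finite]
  refine Finset.sum_congr rfl fun b _ => ?_
  have hb : MeasurableSet (Y ⁻¹' {b}) := hY (measurableSet_singleton b)
  rw [map_measureReal_apply hY (measurableSet_singleton b),
    map_measureReal_apply hY (measurableSet_singleton b), measureReal_restrict_apply hb, h b]
  simp only [smul_eq_mul]
  ring

/-- Given an outcome vector of positive probability, the exponential mechanism selects the observed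
splits with positive probability; so the conditioning event is non-null for every `n`. -/
lemma exists_measure_preimage_singleton_ne_zero {Ω β : Type*} [MeasurableSpace Ω] {P : Measure Ω}
    [NeZero P] [Countable β] (Y : Ω → β) : ∃ b, P (Y ⁻¹' {b}) ≠ 0 := by
  by_contra! h
  refine NeZero.ne P (Measure.measure_univ_eq_zero.1 ?_)
  have hU : Set.univ = ⋃ b, Y ⁻¹' {b} := by ext ω; simp
  rw [hU]
  exact measure_iUnion_null h

/-- Finitely many leaf means that stay away from `0` and `1` stay away from them uniformly. -/
lemma exists_eventually_mem_Icc {m : ℕ} {π : ℕ → Fin m → ℝ}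
    (hπ : ∀ n j, π n j ∈ Set.Ioo (0 : ℝ) 1) (hπ0 : ∀ j, 0 < liminf (fun n => π n j) atTop)
    (hπ1 : ∀ j, limsup (fun n => π n j) atTop < 1) :
    ∃ a > 0, ∀ᶠ n in atTop, ∀ j, π n j ∈ Set.Icc a (1 - a) := by
  have h : ∀ j, ∃ a > 0, ∀ᶠ n in atTop, π n j ∈ Set.Icc a (1 - a) := by
    intro j
    obtain ⟨a₀, h0, h0'⟩ := exists_between (hπ0 j)
    obtain ⟨a₁, h1, h1'⟩ := exists_between (hπ1 j)
    have e0 := eventually_lt_of_lt_liminf h0'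
      (isBoundedUnder_of ⟨0, fun n => (hπ n j).1.le⟩)
    have e1 := eventually_lt_of_limsup_lt h1
      (isBoundedUnder_of ⟨1, fun n => (hπ n j).2.le⟩)
    refine ⟨min a₀ (1 - a₁), lt_min h0 (by linarith), ?_⟩
    filter_upwards [e0, e1] with n hn0 hn1
    exact ⟨(min_le_left _ _).trans hn0.le, by linarith [min_le_right a₀ (1 - a₁)]⟩
  choose a ha hae using h
  obtain ⟨b, hb0, hb⟩ : ∃ b > 0, ∀ j, b ≤ a j := by
    rcases isEmpty_or_nonempty (Fin m) with hm | hm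
    · exact ⟨1, one_pos, fun j => hm.elim j⟩
    · obtain ⟨j, hj⟩ := Finite.exists_min a
      exact ⟨a j, ha j, hj⟩
  refine ⟨b, hb0, ?_⟩
  filter_upwards [eventually_all.2 hae] with n hn j
  exact ⟨(hb j).trans (hn j).1, by linarith [(hn j).2, hb j]⟩

section Asymptotics

variable {𝒳 : Type*} {d m : ℕ} {k : Fin d → ℕ} [NeZero m] [∀ h, NeZero (k h)]
  {X : (n : ℕ) → Fin n → 𝒳} {t : ℕ → TreeFit 𝒳 d m k}

/-! ## Asymptotics along the sequence of samples -/

/-- An internal region contains each of its candidate parts, so its count diverges along with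
theirs. -/
lemma tendsto_count_pathRegion
    (hleaf : limsup (fun n : ℕ => (n : ℝ≥0∞) / (count (X n) ((t n).leaf 0) : ℝ≥0∞)) atTop < ∞)
    (hchild : ∀ h j,
      limsup (fun n : ℕ => (n : ℝ≥0∞) / (count (X n) ((t n).child h j) : ℝ≥0∞)) atTop < ∞)
    (hcompl : ∀ h j,
      limsup (fun n : ℕ => (n : ℝ≥0∞) /
        (count (X n) ((t n).node h.castSucc \ (t n).child h j) : ℝ≥0∞)) atTop < ∞) :
    ∀ r, Tendsto (fun n => count (X n) ((t n).pathRegion r)) atTop atTop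
  | none => tendsto_of_limsup_div_lt_top hleaf
  | some (a, 0) => tendsto_atTop_mono
      (fun n => count_mono (X n) ((t n).child_subset a.1 a.2))
      (tendsto_of_limsup_div_lt_top (hchild a.1 a.2))
  | some (a, 1) => tendsto_of_limsup_div_lt_top (hchild a.1 a.2)
  | some (a, 2) => tendsto_of_limsup_div_lt_top (hcompl a.1 a.2)

variable {π : ℕ → Fin m → ℝ} {Ω : ℕ → Type*} [∀ n, MeasurableSpace (Ω n)]
  {P : (n : ℕ) → Measure (Ω n)} [∀ n, IsProbabilityMeasure (P n)] {Y : (n : ℕ) → Fin n → Ω n → Bool}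

/-- The main statistic, standardized and transformed by the standard normal distribution function,
is asymptotically uniform. -/
lemma tendstoInDistribution_cdf_mainStat (hπ : ∀ n j, π n j ∈ Set.Ioo (0 : ℝ) 1)
    (hYm : ∀ n i, Measurable (Y n i)) (hYind : ∀ n, iIndepFun (Y n) (P n))
    (hYlaw : ∀ n i, P n {ω | Y n i ω = true} = ENNReal.ofReal ((t n).theta (π n) (X n i)))
    (hcount : Tendsto (fun n => count (X n) ((t n).leaf 0)) atTop atTop) {a : ℝ} (ha : 0 < a)
    (hπa : ∀ᶠ n in atTop, ∀ j, π n j ∈ Set.Icc a (1 - a)) :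
    TendstoInDistribution (fun n ω => cdf (gaussianReal 0 1)
      ((√(π n 0 * (1 - π n 0)))⁻¹ * (mainStat (t n) (X n) (fun i => Y n i ω) -
        √(count (X n) ((t n).leaf 0)) * π n 0))) atTop (fun x : ℝ => x) P uniformLaw := by
  classical
  have hJ : ∀ n, (Finset.univ.filter fun i => X n i ∈ (t n).leaf 0).card =
      count (X n) ((t n).leaf 0) := fun n => by
    rw [count, Set.ncard_eq_toFinset_card']
    simp
  refine tendstoInDistribution_cdf_gaussian ?_
  convert tendstoInDistribution_bernoulli_array (P := P) hYm hYind ha (fun n => (hπ n 0).1.le)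
    (hπa.mono fun n h => h 0) (J := fun n => Finset.univ.filter fun i => X n i ∈ (t n).leaf 0)
    (by simpa only [hJ] using hcount) (fun n i hi => by
      rw [hYlaw, (t n).theta_eq (π n) (Finset.mem_filter.1 hi).2]) using 3 with n ω
  have hsum : ∑ i with X n i ∈ (t n).leaf 0, ((if Y n i ω then (1 : ℝ) else 0) - π n 0) =
      count (X n) ((t n).leaf 0) * (prop (X n) (fun i => Y n i ω) ((t n).leaf 0) - π n 0) := by
    rw [Finset.sum_sub_distrib, Finset.sum_const, hJ, mul_sub, count_mul_prop, Finset.sum_filter,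
      nsmul_eq_mul]
    congr 1
    refine Finset.sum_congr rfl fun i _ => ?_
    by_cases hi : X n i ∈ (t n).leaf 0 <;> simp [hi]
  rw [hsum, hJ, Real.sqrt_mul (Nat.cast_nonneg (count (X n) ((t n).leaf 0))), mul_inv, mainStat]
  set N : ℝ := (count (X n) ((t n).leaf 0) : ℝ) with hN
  have hN0 : 0 ≤ N := by positivity
  have h1 : (√N)⁻¹ * N = √N := by rw [inv_mul_eq_div, Real.div_sqrt]
  linear_combination -((√(π n 0 * (1 - π n 0)))⁻¹ *
    (prop (X n) (fun i => Y n i ω) ((t n).leaf 0) - π n 0)) * h1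

/-- With high probability, all proportions are close to their means. -/
lemma tendsto_measureReal_exists_abs_prop_sub (hπ : ∀ n j, π n j ∈ Set.Ioo (0 : ℝ) 1)
    (hYm : ∀ n i, Measurable (Y n i)) (hYind : ∀ n, iIndepFun (Y n) (P n))
    (hYlaw : ∀ n i, P n {ω | Y n i ω = true} = ENNReal.ofReal ((t n).theta (π n) (X n i)))
    (hcount : ∀ r, Tendsto (fun n => count (X n) ((t n).pathRegion r)) atTop atTop) {δ : ℝ}
    (hδ : 0 < δ) :
    Tendsto (fun n => (P n).real {ω | ∃ r, δ < |prop (X n) (fun i => Y n i ω) ((t n).pathRegion r) -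
      propMean (X n) ((t n).theta (π n)) ((t n).pathRegion r)|}) atTop (𝓝 0) := by
  have hlim : Tendsto (fun n => ∑ r : Option (NuisIdx k × Fin 3),
      (δ ^ 2)⁻¹ * (count (X n) ((t n).pathRegion r) : ℝ)⁻¹) atTop (𝓝 0) := by
    have h : ∀ r ∈ (Finset.univ : Finset (Option (NuisIdx k × Fin 3))),
        Tendsto (fun n => (δ ^ 2)⁻¹ * (count (X n) ((t n).pathRegion r) : ℝ)⁻¹) atTop (𝓝 0) :=
      fun r _ => by
        simpa using (tendsto_inv_atTop_zero.comp
          (tendsto_natCast_atTop_atTop.comp (hcount r))).const_mul (δ ^ 2)⁻¹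
    simpa using tendsto_finsetSum _ h
  refine squeeze_zero (fun n => measureReal_nonneg) (fun n => ?_) hlim
  rw [Set.ofPred_exists]
  refine (measureReal_iUnion_fintype_le _).trans (Finset.sum_le_sum fun r _ => ?_)
  exact measureReal_abs_prop_sub_le (X n) (hYm n) (hYind n)
    (fun i => ((t n).theta_mem (hπ n) _).1.le) (hYlaw n) _ hδ

end Asymptotics

end ExpTree

end

/-! ### Proof of the main theorem -/

theorem theorem1
    {𝒳 : Type*} {d m : ℕ} {k : Fin d → ℕ} [NeZero m] [∀ h, NeZero (k h)]
    -- impurity function and temperature parameters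
    (I : ℝ → ℝ) (ε : Fin d → ℝ)
    -- for every sample size `n`: predictors, observed tree fit, means of the leaves
    (X : (n : ℕ) → Fin n → 𝒳) (t : ℕ → ExpTree.TreeFit 𝒳 d m k) (π : ℕ → Fin m → ℝ)
    (hπ : ∀ n j, π n j ∈ Set.Ioo (0 : ℝ) 1)
    -- for every sample size `n`: a probability space with the outcomes and the random splits
    {Ω : ℕ → Type*} [∀ n, MeasurableSpace (Ω n)] (P : (n : ℕ) → Measure (Ω n))
    [∀ n, IsProbabilityMeasure (P n)]
    (Y : (n : ℕ) → Fin n → Ω n → Bool) (S : (n : ℕ) → (h : Fin d) → Ω n → Fin (k h))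
    (hYm : ∀ n i, Measurable (Y n i)) (hSm : ∀ n h, Measurable (S n h))
    -- the outcomes are independent Bernoulli variables
    (hYind : ∀ n, iIndepFun (Y n) (P n))
    (hYlaw : ∀ n i, P n {ω | Y n i ω = true} = ENNReal.ofReal ((t n).theta (π n) (X n i)))
    -- given the outcomes, the splits are drawn independently by the exponential mechanism
    (hS : ∀ n (y : Fin n → Bool) (s : (h : Fin d) → Fin (k h)),
      P n {ω | (∀ i, Y n i ω = y i) ∧ ∀ h, S n h ω = s h} =
        P n {ω | ∀ i, Y n i ω = y i} *
          ∏ h, ENNReal.ofReal (ExpTree.splitProb I (ε h) (X n) y ((t n).node h.castSucc)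
            ((t n).child h) (s h)))
    -- the numbers of samples in all relevant regions grow proportionally with `n`
    (hleaf : limsup (fun n : ℕ => (n : ℝ≥0∞) / (ExpTree.count (X n) ((t n).leaf 0) : ℝ≥0∞)) atTop < ∞)
    (hchild : ∀ h j,
      limsup (fun n : ℕ => (n : ℝ≥0∞) / (ExpTree.count (X n) ((t n).child h j) : ℝ≥0∞)) atTop < ∞)
    (hcompl : ∀ h j,
      limsup (fun n : ℕ => (n : ℝ≥0∞) /
        (ExpTree.count (X n) ((t n).node h.castSucc \ (t n).child h j) : ℝ≥0∞)) atTop < ∞)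
    -- the means of the leaves stay away from `0` and `1`
    (hπ0 : ∀ j, 0 < liminf (fun n => π n j) atTop)
    (hπ1 : ∀ j, limsup (fun n => π n j) atTop < 1)
    -- the eigenvalues of the covariance matrix stay away from `0` and `∞`
    (hcov : ∃ b B : ℝ, 0 < b ∧ 0 < B ∧ ∀ᶠ n in atTop,
      (ExpTree.covMatrix (t n) (X n) (Y n) (P n)).PosDef ∧
        ∀ x ∈ spectrum ℝ (ExpTree.covMatrix (t n) (X n) (Y n) (P n)), 1 / b ^ 2 < x ∧ x < B ^ 2)
    -- regularity of the impurity function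
    (hI : ExpTree.BoundedThriceDiff I) :
    ∃ _ : ∀ n, IsProbabilityMeasure ((P n)[|{ω | ∀ h, S n h ω = 0}]),
      TendstoInDistribution
        (fun n ω => ExpTree.pivot I ε (t n) (X n) (π n 0) (fun i => Y n i ω)) atTop
        (fun x : ℝ => x) (fun n => (P n)[|{ω | ∀ h, S n h ω = 0}])
        ExpTree.uniformLaw := by
  open ExpTree in
  have hYm' : ∀ n, Measurable fun ω => fun i => Y n i ω := fun n => measurable_pi_iff.2 (hYm n)
  have hpre : ∀ n (y : Fin n → Bool), (fun ω => fun i => Y n i ω) ⁻¹' {y} =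
      {ω | ∀ i, Y n i ω = y i} := fun n y => by ext ω; simp [funext_iff]
  have hS0 := fun n y => hS n y fun _ => 0
  have hsplit0 : ∀ n (y : Fin n → Bool) h, 0 < splitProb I (ε h) (X n) y
      ((t n).node h.castSucc) ((t n).child h) 0 := fun n y h =>
    div_pos (Real.exp_pos _) (Finset.sum_pos (fun _ _ => Real.exp_pos _) Finset.univ_nonempty)
  have hprob : ∀ n, IsProbabilityMeasure ((P n)[|{ω | ∀ h, S n h ω = 0}]) := fun n => by
    obtain ⟨y, hy⟩ := exists_measure_preimage_singleton_ne_zero (P := P n)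
      fun ω => fun i => Y n i ω
    rw [hpre] at hy
    refine cond_isProbabilityMeasure fun h0 => ?_
    have h1 := measure_mono_null (fun ω hω => hω.2 :
      {ω | (∀ i, Y n i ω = y i) ∧ ∀ h, S n h ω = 0} ⊆ {ω | ∀ h, S n h ω = 0}) h0
    rw [hS0] at h1
    refine mul_ne_zero hy (Finset.prod_ne_zero_iff.2 fun h _ => ?_) h1
    exact (ENNReal.ofReal_pos.2 (hsplit0 n y h)).ne'
  refine ⟨hprob, ?_⟩
  obtain ⟨hIc, C, hC0, hCI, hCL⟩ := hI.exists_bound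
  obtain ⟨c, hc, hcε⟩ := exists_le_selectionProb (k := k) ε (K := 2 * C) (by positivity)
  obtain ⟨a, ha, hπa⟩ := exists_eventually_mem_Icc hπ hπ0 hπ1
  have hcount := tendsto_count_pathRegion hleaf hchild hcompl
  have hpos : ∀ᶠ n in atTop, ∀ r, 0 < count (X n) ((t n).pathRegion r) :=
    eventually_all.2 fun r => (hcount r).eventually_gt_atTop 0
  have hmean : ∀ᶠ n in atTop, ∀ r, propMean (X n) ((t n).theta (π n)) ((t n).pathRegion r) ∈
      Set.Icc a (1 - a) := by
    filter_upwards [hpos, hπa] with n hn hna r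
    exact propMean_mem_Icc (X n) ((t n).theta_mem hna) (hn r)
  -- `U` is the transformed main statistic, `W` the conditional selection probability given the
  -- outcomes, and `w` its value at the mean proportions.
  refine tendstoInDistribution_cond
    (U := fun n ω => cdf (gaussianReal 0 1) ((√(π n 0 * (1 - π n 0)))⁻¹ *
      (mainStat (t n) (X n) (fun i => Y n i ω) - √(count (X n) ((t n).leaf 0)) * π n 0)))
    (W := fun n ω => selectionProb ε fun h j =>
      gain I (X n) (fun i => Y n i ω) ((t n).node h.castSucc) ((t n).child h j))
    (w := fun n => selectionProb ε (meanGain (t n) (X n) I ((t n).theta (π n))))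
    (fun n => ?_) (fun n => ?_) (fun n => ?_) (fun n ω => (selectionProb_pos ε _).le)
    (fun n ω => selectionProb_le_one ε _) hc (fun n => (selectionProb_pos ε _).le)
    (fun n => selectionProb_le_one ε _) ?_ (fun κ hκ => ?_) (fun n f => ?_)
    (tendstoInDistribution_cdf_mainStat hπ hYm hYind hYlaw (hcount none) ha hπa)
  -- Measurability is automatic, as the outcome vector takes values in a finite type.
  · exact (measurable_of_countable (pivot I ε (t n) (X n) (π n 0))).comp (hYm' n)
  · exact (measurable_of_countable fun y => cdf (gaussianReal 0 1) ((√(π n 0 * (1 - π n 0)))⁻¹ *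
      (mainStat (t n) (X n) y - √(count (X n) ((t n).leaf 0)) * π n 0))).comp (hYm' n)
  · exact (measurable_of_countable fun y => selectionProb ε fun h j =>
      gain I (X n) y ((t n).node h.castSucc) ((t n).child h j)).comp (hYm' n)
  · filter_upwards [hmean] with n hn
    exact hcε _ (abs_meanGain_le ha hCI hn)
  -- With `κ' ≤ c κ / 4` and `1 / M² = c κ / 4`, the pivot error `2 (κ' + 1 / M²) / c` is at most
  -- `κ`.
  · set κ' := min κ (c * κ / 4) with hκ'
    have hκ'0 : 0 < κ' := lt_min hκ (by positivity)
    obtain ⟨δ₁, hδ₁, hκε⟩ := exists_abs_selectionProb_sub_le (k := k) ε (K := 2 * C)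
      (by positivity) hκ'0
    -- The first entry keeps the proportions inside `(0, 1)`, the second makes the gain error at
    -- most `δ₁`; `C + 1` replaces `C`, which may be zero.
    set δ := min (a / 6) (δ₁ / (6 * (C + 1))) with hδdef
    have hδ : 0 < δ := lt_min (by positivity) (by positivity)
    have hδa : 3 * δ < a := by linarith [min_le_left (a / 6) (δ₁ / (6 * (C + 1)))]
    have hδδ₁ : 2 * (C * (3 * δ)) ≤ δ₁ := by
      have h1 : δ * (6 * (C + 1)) ≤ δ₁ :=
        (le_div_iff₀ (by positivity)).1 (min_le_right (a / 6) (δ₁ / (6 * (C + 1))))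
      linarith
    set M := √(4 / (c * κ)) with hMdef
    have hM0 : 0 < M := Real.sqrt_pos.2 (by positivity)
    have hM2 : 1 / M ^ 2 = c * κ / 4 := by
      rw [hMdef, Real.sq_sqrt (by positivity), one_div_div]
    have hMlarge : ∀ᶠ n in atTop, M ≤ δ * √(count (X n) ((t n).leaf 0)) := by
      have h1 := (Real.tendsto_sqrt_atTop.comp
        (tendsto_natCast_atTop_atTop.comp (hcount none))).eventually_ge_atTop (M / δ)
      filter_upwards [h1] with n hn
      rw [div_le_iff₀' hδ] at hn
      exact hn
    -- For large `n`, the bad event forces some proportion to be farther than `δ` from its mean.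
    refine squeeze_zero' (Eventually.of_forall fun n => measureReal_nonneg) ?_
      (tendsto_measureReal_exists_abs_prop_sub hπ hYm hYind hYlaw hcount hδ)
    filter_upwards [hpos, hmean, hMlarge] with n hn1 hn2 hn3
    refine measureReal_mono fun ω hω => ?_
    rw [Set.mem_ofPred_eq] at hω ⊢
    by_contra! hdev
    obtain ⟨h1, h2⟩ := abs_selectionProb_sub_and_abs_pivot_sub_le hIc hC0 hCI hCL hc hcε hκ'0.le
      hκε hn1 hn2 hdev hδa hδδ₁ hM0 hn3
      (propMean_eq_of_eqOn (X n) (fun x hx => (t n).theta_eq (π n) hx) (hn1 none)) (hπ n 0)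
    rcases hω with hω | hω
    · exact absurd (h1.trans (min_le_left _ _)) (not_le.2 hω)
    · refine absurd (h2.trans ?_) (not_le.2 hω)
      rw [div_le_iff₀ hc, hM2]
      linarith [min_le_right κ (c * κ / 4)]
  -- Given `Y = y`, the observed splits have probability equal to the product of the `splitProb`,
  -- which is `W` at `y`.
  · refine setIntegral_comp_eq_integral_mul (hYm' n) (w := fun y => selectionProb ε fun h j =>
      gain I (X n) y ((t n).node h.castSucc) ((t n).child h j)) (fun y => ?_)
      fun y => f (pivot I ε (t n) (X n) (π n 0) y)
    have h1 : {ω | ∀ i, Y n i ω = y i} ∩ {ω | ∀ h, S n h ω = 0} =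
        {ω | (∀ i, Y n i ω = y i) ∧ ∀ h, S n h ω = 0} := rfl
    rw [hpre, h1, measureReal_def, hS0, ENNReal.toReal_mul, ENNReal.toReal_prod,
      ← prod_splitProb_eq]
    congr 1
    exact Finset.prod_congr rfl fun h _ => ENNReal.toReal_ofReal (hsplit0 n y h).le
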